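/- **Setting.** Serve an online sequence of requests $\langle$Insert, name, length$\rangle$ (positive integral length, name not in use) and $\langle$Delete, name$\rangle$ (name of an active object), starting from no objects, storing the objects in an array with addresses $0,1,2,\dots$. A cost function $f$ is monotonically increasing (not necessarily strictly) and subadditive on positive integers; it is unknown to the algorithm. The cost of a request is the sum of $f(\text{length})$ over all writes of objects made while it is served: the initial placement of an inserted object and every single move of an object. $\Delta$ is the length of the longest object inserted so far (the present request included). Let $0<\epsilon'\le 1/2$. **Deamortized reallocator.** Size class $i$ consists of the lengths $w$ with $2^{i-1}\le w<2^i$. The array consists of one region per size class, in increasing order, each a payload segment followed by a buffer segment, and then a tail buffer. Initially all segments have size $0$. *Update when no flush is in progress.* An inserted object of class $i$ is written at the end of the earliest buffer $j\ge i$ with enough unoccupied space (the tail buffer counts as the last one). If all size classes $\ge i$ have payload segments of size $0$ and the tail buffer is empty, then instead a new region with payload size $w$ (holding the object) and an empty buffer of size $\lfloor\epsilon' w\rfloor$ is created just before the tail buffer. If no buffer has space, the object is written at the end of the tail buffer, exceeding it, and triggers a flush. A deleted object leaves a hole, and a dummy delete record of its size is stored in a buffer by the same first-fit rule; if it fits nowhere,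 it is not stored and a flush is triggered. *Flush.* Let $b$ be the largest number such that the triggering update and everything in the buffers $i\ge b$ (including the tail buffer, delete records and holes of deleted objects) belong to size classes $\ge b$. With $V(i)$ the volume of the remaining objects of class $i$ and $V_f$ the volume of all remaining objects at the time the flush is triggered, the new boundaries give, for each $i\ge b$, space $V(i)$ to payload segment $i$ and $\lfloor\epsilon'V(i)\rfloor$ to buffer $i$, and $\lfloor\epsilon' V_f\rfloor$ to the tail buffer; these buffers are then empty. Let $L$ and $L'$ be the endpoints of the occupied space before and of the whole structure after the flush, both minus the length of the triggering object if the trigger is an insert, let $B$ be the total size of the buffers flushed (including the tail buffer), and $M=\max\{L,L'\}+B+\Delta$. The moves are, in order: the buffered objects of the flushed buffers to consecutive addresses from $M$ on; the payload objects of classes $\ge b$, from last to first, packed so as to end at $M$; the payload objects, from first to last, to their final places; the buffered objects to the ends of their payload segments. No move is made during the triggering request. The space after this working space is the log. *Update of size $w$ when a flush is in progress.* The update (an inserted object, or a delete record) is put at the end of the log; then the next steps of the flush are performed as long as the volume processed in this request is at most $(4/\epsilon')w$ (so the last step may exceed this volume). After the moves above, the steps are to re-insert/re-delete the log entries, in order,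 each as in an update when no flush is in progress and counted with its size as volume. The flush ends when no moves and no log entries remain; if a re-inserted/re-deleted entry triggers a new flush, no further step is performed in this request (any unprocessed log entries stay in the log of the new flush). **Lemma.** There is an absolute constant $C>0$ such that for every $0<\epsilon'\le 1/2$, every monotonically increasing subadditive $f$, and every legal request sequence, whose $t$-th request inserts or deletes an object of length $w_t$: 1. (amortized cost $O(f(w)(1/\epsilon')\lg(1/\epsilon'))$) the total cost of all requests is at most $\sum_t C\, f(w_t)\,(1/\epsilon')\lg(1/\epsilon')$; 2. (worst-case cost) for each $t$, the cost of the $t$-th request is at most $C\left((1/\epsilon')\,w_t f(1)+f(\Delta)\right)$. -/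

import Mathlib

namespace StorageReallocation

universe u

variable {α : Type u} [DecidableEq α]

/-! ### Requests, active objects, cost functions -/

/-- A request: `⟨InsertObject, name, length⟩` or `⟨DeleteObject, name⟩`. -/
inductive Request (α : Type u) where
  | insert (name : α) (len : ℕ)
  | delete (name : α)

/-- The table of active objects (name ↦ length) after one more request. -/
def Request.apply (act : α → Option ℕ) : Request α → (α → Option ℕ)
  | .insert x w => Function.update act x (some w)
  | .delete x => Function.update act x none

/-- The table of active objects after a sequence of requests, starting from no objects. -/
def active (σ : List (Request α)) : α → Option ℕ :=
  σ.foldl Request.apply (fun _ => none)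

/-- The request is legal: an inserted object has positive integral length and its name is not in use;
a deleted object is active. -/
def Request.Legal (act : α → Option ℕ) : Request α → Prop
  | .insert x w => 1 ≤ w ∧ act x = none
  | .delete x => act x ≠ none

/-- An online execution all of whose requests are legal when they are issued. -/
def IsExecution (σ : List (Request α)) : Prop :=
  ∀ (t : ℕ) (ht : t < σ.length), (σ[t]).Legal (active (σ.take t))

/-- The length of the object that the request inserts or deletes. -/
def Request.len (act : α → Option ℕ) : Request α → ℕ
  | .insert _ w => w
  | .delete x => (act x).getD 0

/-- The length of the longest object inserted by a sequence of requests (`Δ`). -/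
def longest : List (Request α) → ℕ
  | [] => 0
  | .insert _ w :: σ => max w (longest σ)
  | .delete _ :: σ => longest σ

/-- Monotone subadditive cost functions on (positive, integral) lengths. -/
structure IsCostFunction (f : ℕ → ℝ) : Prop where
  mono : ∀ x y, 0 < x → x ≤ y → f x ≤ f y
  subadd : ∀ x y, 0 < x → 0 < y → f (x + y) ≤ f x + f y

/-! ### The array -/

/-- A piece of the array holding `size` consecutive addresses from `addr` on.  If `live`, it stores the
object `name`; otherwise it is the hole left by that object in a buffer, or a (dummy) delete record. -/
structure Cell (α : Type u) where
  name : α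
  size : ℕ
  addr : ℕ
  live : Bool

/-- The size class `i` of lengths `w` with `2 ^ (i - 1) ≤ w < 2 ^ i`. -/
def sizeClass (w : ℕ) : ℕ := Nat.size w

/-- Total size of a list of cells. -/
def vol (l : List (Cell α)) : ℕ := (l.map Cell.size).sum

/-- The cells that store objects. -/
def liveCells (l : List (Cell α)) : List (Cell α) := l.filter (fun c => c.live)

/-- The cells whose size belongs to size class `k`. -/
def ofClass (k : ℕ) (l : List (Cell α)) : List (Cell α) :=
  l.filter (fun c => sizeClass c.size = k)

/-- Lay the cells out contiguously, in order, from address `s` on. -/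
def layOut : ℕ → List (Cell α) → List (Cell α)
  | _, [] => []
  | s, c :: l => { c with addr := s } :: layOut (s + c.size) l

/-- The region of one size class: a payload segment of length `paySpace` followed by a buffer segment
of length `bufSpace`. The payload list holds the stored objects only (deleted ones leave holes); the
buffer list holds everything written to the buffer since its last flush. -/
structure Region (α : Type u) where
  payload : List (Cell α)
  paySpace : ℕ
  buffer : List (Cell α)
  bufSpace : ℕ

/-- The regions of the size classes, followed by the tail buffer; `maxLen` is the length `Δ` of the
longest object seen so far. -/
structure Layout (α : Type u) where
  region : ℕ → Region α
  tail : List (Cell α)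
  tailSpace : ℕ
  maxLen : ℕ

namespace Layout

/-- The size classes are `1, …, ⌊lg Δ⌋ + 1`. -/
def numClasses (D : Layout α) : ℕ := sizeClass D.maxLen

/-- The size classes `b, b + 1, …, ⌊lg Δ⌋ + 1`, in increasing order. -/
def classesFrom (D : Layout α) (b : ℕ) : List ℕ :=
  (List.range (D.numClasses + 1)).filter (fun k => b ≤ k)

/-- First address of region `i`. -/
def regionStart (D : Layout α) (i : ℕ) : ℕ :=
  ∑ j ∈ Finset.range i, ((D.region j).paySpace + (D.region j).bufSpace)

/-- First address of the tail buffer. -/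
def tailStart (D : Layout α) : ℕ := D.regionStart (D.numClasses + 1)

/-- Write a cell at the end of the earliest buffer `j ≥ sizeClass w` with enough unoccupied space, the
tail buffer being the last one; `none` if there is no such buffer.  Also returns the cell written. -/
def store (D : Layout α) (x : α) (w : ℕ) (live : Bool) : Option (Layout α × Cell α) :=
  match (D.classesFrom (sizeClass w)).find?
      (fun j => vol (D.region j).buffer + w ≤ (D.region j).bufSpace) with
  | some j =>
      let R := D.region j
      let c : Cell α := ⟨x, w, D.regionStart j + R.paySpace + vol R.buffer, live⟩
      some ({ D with region := Function.update D.region j { R with buffer := R.buffer ++ [c] } }, c)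
  | none =>
      if vol D.tail + w ≤ D.tailSpace then
        let c : Cell α := ⟨x, w, D.tailStart + vol D.tail, live⟩
        some ({ D with tail := D.tail ++ [c] }, c)
      else none

/-- Remove object `x`: it leaves a hole. -/
def remove (D : Layout α) (x : α) : Layout α :=
  let kill (c : Cell α) : Cell α := if c.name = x then { c with live := false } else c
  { D with
    region := fun k =>
      { D.region k with
        payload := (D.region k).payload.filter (fun c => c.name ≠ x)
        buffer := (D.region k).buffer.map kill }
    tail := D.tail.map kill }

/-- Move object `m.name` of a payload list to address `m.addr`. -/
def relocate (D : Layout α) (m : Cell α) : Layout α :=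
  { D with
    region := fun k =>
      { D.region k with
        payload := (D.region k).payload.map
          (fun c => if c.name = m.name then { c with addr := m.addr } else c) } }

/-- The boundary size class of a flush triggered by an update of size class `s`: the largest `b` such
that the triggering update and everything in the buffers `i ≥ b` (the tail buffer included) belong
to size classes `≥ b`. -/
def boundary (D : Layout α) (s : ℕ) : ℕ :=
  Nat.findGreatest
    (fun b => (∀ c ∈ D.tail, b ≤ sizeClass c.size) ∧
      ∀ j ∈ D.classesFrom b, ∀ c ∈ (D.region j).buffer, b ≤ sizeClass c.size) s

/-- Total volume of the objects in the regions and the tail buffer. -/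
def volume (D : Layout α) : ℕ :=
  ((D.classesFrom 0).map
    (fun k => vol (D.region k).payload + vol (liveCells (D.region k).buffer))).sum
    + vol (liveCells D.tail)

/-- The objects stored in the buffers `i ≥ b`, the tail buffer included. -/
def buffered (D : Layout α) (b : ℕ) : List (Cell α) :=
  (D.classesFrom b).flatMap (fun k => liveCells (D.region k).buffer) ++ liveCells D.tail

/-- The new segment boundaries of a flush of the size classes `≥ b`: payload segment `k` gets space
`V(k)`, buffer `k` gets space `⌊ε V(k)⌋`, the tail buffer gets `⌊ε V⌋`; all these buffers are empty.
The objects still carry the addresses they had when the flush was triggered. -/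
noncomputable def target (ε : ℝ) (D : Layout α) (b : ℕ) : Layout α :=
  { D with
    region := fun k =>
      if b ≤ k then
        let l := (D.region k).payload ++ ofClass k (D.buffered b)
        { payload := l, paySpace := vol l, buffer := [], bufSpace := ⌊ε * (vol l : ℝ)⌋₊ }
      else D.region k
    tail := []
    tailSpace := ⌊ε * (D.volume : ℝ)⌋₊ }

end Layout

/-! ### Flushes -/

/-- A flush in progress: the moves still to be made (each cell gives the object and its destination),
the part of the log that has not been re-inserted/re-deleted yet (live cells are inserted objects, the
others delete records), and the first address after the log. -/
structure Flush (α : Type u) where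
  moves : List (Cell α)
  log : List (Cell α)
  logEnd : ℕ

/-- Trigger a flush by an update of size class `s`.  For an insert of a size-`w` object, that object
is already the last one in the tail buffer of `D`; for a delete, `w = 0`.  No object is moved yet. -/
noncomputable def startFlush (ε : ℝ) (D : Layout α) (s w : ℕ) : Layout α × Flush α :=
  let b := D.boundary s
  let D' := D.target ε b
  -- space before and after the flush, without the triggering insert
  let L := D.tailStart + vol D.tail - w
  let L' := D'.tailStart + D'.tailSpace - w
  -- space of the flushed buffers
  let B := ((D.classesFrom b).map (fun k => (D.region k).bufSpace)).sum + D.tailSpace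
  let M := max L L' + B + D.maxLen
  let buf := D.buffered b
  let pay := (D.classesFrom b).flatMap (fun k => (D.region k).payload)
  -- the buffered objects go to the working space from `M` on
  let moves₁ := layOut M buf
  -- the payload objects are packed, last one first, so as to end at `M`
  let moves₂ := (layOut (M - vol pay) pay).reverse
  -- the payload objects go to their final places, first one first
  let moves₃ := (D.classesFrom b).flatMap
    (fun k => layOut (D'.regionStart k) (D.region k).payload)
  -- the buffered objects go to the ends of their payload segments
  let moves₄ := (D.classesFrom b).flatMap
    (fun k => layOut (D'.regionStart k + vol (D.region k).payload) (ofClass k buf))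
  (D', { moves := moves₁ ++ moves₂ ++ moves₃ ++ moves₄
         log := []
         logEnd := M + vol buf })

/-- Insert an object when no flush move is pending.  If its size class is larger than every existing
one (and the tail buffer is empty, so that it can be shifted), a new region is created for it, located
before the tail buffer.  Otherwise it is stored in a buffer; if no buffer has enough space it is put at
the end of the tail buffer, exceeding it, and triggers a flush.
Returns the new layout, the triggered flush if any, and the cell written. -/
noncomputable def insertObject (ε : ℝ) (D : Layout α) (x : α) (w : ℕ) :
    Layout α × Option (Flush α) × Cell α :=
  let i := sizeClass w
  if D.tail.isEmpty ∧ ∀ j ∈ D.classesFrom i, (D.region j).paySpace = 0 then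
    let c : Cell α := ⟨x, w, D.regionStart i, true⟩
    let R : Region α := ⟨[c], w, [], ⌊ε * (w : ℝ)⌋₊⟩
    ({ D with region := Function.update D.region i R }, none, c)
  else
    match D.store x w true with
    | some (D', c) => (D', none, c)
    | none =>
        let c : Cell α := ⟨x, w, D.tailStart + vol D.tail, true⟩
        let F := startFlush ε { D with tail := D.tail ++ [c] } i w
        (F.1, some F.2, c)

/-- Delete an object of size `w` when no flush move is pending: it leaves a hole, and a delete record of
size `w` is stored in a buffer; if no buffer has enough space, a flush is triggered. -/
noncomputable def deleteObject (ε : ℝ) (D : Layout α) (x : α) (w : ℕ) :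
    Layout α × Option (Flush α) :=
  match (D.remove x).store x w false with
  | some (D', _) => (D', none)
  | none =>
      let F := startFlush ε (D.remove x) (sizeClass w) 0
      (F.1, some F.2)

/-- A flush with nothing left to do is over. -/
def Flush.settle (F : Flush α) : Option (Flush α) :=
  if F.moves.isEmpty ∧ F.log.isEmpty then none else some F

/-- Carry out pending moves as long as the volume `done` processed so far does not exceed `budget`.
Returns the volume processed, the layout, the moves still pending, and the moves made. -/
noncomputable def runMoves (budget : ℝ) :
    ℕ → Layout α → List (Cell α) → ℕ × Layout α × List (Cell α) × List (Cell α)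
  | done, D, [] => (done, D, [], [])
  | done, D, m :: ms =>
      if (done : ℝ) ≤ budget then
        let r := runMoves budget (done + m.size) (D.relocate m) ms
        (r.1, r.2.1, r.2.2.1, m :: r.2.2.2)
      else (done, D, m :: ms, [])

/-- Re-insert/re-delete the updates in the log, in order, as long as the volume `done` processed so far
does not exceed `budget` and no new flush is triggered. (If a new flush is triggered, the work stops and
the rest of the log, if any, becomes part of the log of the new flush.)
Returns the layout, the flush in progress if any, and the objects moved. -/
noncomputable def runLog (ε budget : ℝ) (logEnd : ℕ) :
    ℕ → Layout α → List (Cell α) → Layout α × Option (Flush α) × List (Cell α)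
  | _, D, [] => (D, none, [])
  | done, D, c :: cs =>
      if (done : ℝ) ≤ budget then
        let r : Layout α × Option (Flush α) × List (Cell α) :=
          if c.live then
            let q := insertObject ε D c.name c.size
            (q.1, q.2.1, [q.2.2])
          else
            let q := deleteObject ε D c.name c.size
            (q.1, q.2, [])
        match r.2.1 with
        | none =>
            let q := runLog ε budget logEnd (done + c.size) r.1 cs
            (q.1, q.2.1, r.2.2 ++ q.2.2)
        | some F =>
            let F' : Flush α :=
              { F with
                log := cs
                logEnd := if cs.isEmpty then F.logEnd else max F.logEnd logEnd }
            (r.1, F'.settle, r.2.2)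
      else (D, some ⟨[], c :: cs, logEnd⟩, [])

/-- Perform just over `budget` steps, by volume, of the flush `F`. -/
noncomputable def work (ε budget : ℝ) (D : Layout α) (F : Flush α) :
    Layout α × Option (Flush α) × List (Cell α) :=
  let r := runMoves budget 0 D F.moves
  if r.2.2.1.isEmpty then
    let q := runLog ε budget F.logEnd r.1 r.2.1 F.log
    (q.1, q.2.1, r.2.2.2 ++ q.2.2)
  else (r.2.1, some { F with moves := r.2.2.1 }, r.2.2.2)

/-! ### The deamortized reallocator -/

/-- State of the reallocator between two requests. -/
structure State (α : Type u) where
  table : α → Option ℕ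
  layout : Layout α
  flush : Option (Flush α)

/-- The empty data structure. -/
def State.init : State α where
  table := fun _ => none
  layout := { region := fun _ => ⟨[], 0, [], 0⟩, tail := [], tailSpace := 0, maxLen := 0 }
  flush := none

/-- Serve one request.  If no flush is in progress the update goes to the buffers, possibly triggering
a flush, whose work is left to the subsequent updates.  If a flush is in progress, the update is put at
the end of the log, and just over `(4 / ε) w` steps of the flush are performed, by volume.
Returns the new state and the list of all cells to which an object was written meanwhile: the initial
placement of an inserted object, and every single move of an object. -/
noncomputable def serve (ε : ℝ) (S : State α) (r : Request α) : State α × List (Cell α) :=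
  match r with
  | .insert x w =>
      let D : Layout α := { S.layout with maxLen := max S.layout.maxLen w }
      match S.flush with
      | none =>
          let q := insertObject ε D x w
          (⟨r.apply S.table, q.1, q.2.1.bind Flush.settle⟩, [q.2.2])
      | some F =>
          let c : Cell α := ⟨x, w, F.logEnd, true⟩
          let q := work ε (4 / ε * w) D { F with log := F.log ++ [c], logEnd := F.logEnd + w }
          (⟨r.apply S.table, q.1, q.2.1⟩, c :: q.2.2)
  | .delete x =>
      let w := (S.table x).getD 0
      match S.flush with
      | none =>
          let q := deleteObject ε S.layout x w
          (⟨r.apply S.table, q.1, q.2.bind Flush.settle⟩, [])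
      | some F =>
          let c : Cell α := ⟨x, w, F.logEnd, false⟩
          let q := work ε (4 / ε * w) S.layout { F with log := F.log ++ [c], logEnd := F.logEnd + w }
          (⟨r.apply S.table, q.1, q.2.1⟩, q.2.2)

/-- The state after a sequence of requests. -/
noncomputable def stateAfter (ε : ℝ) (σ : List (Request α)) : State α :=
  σ.foldl (fun S r => (serve ε S r).1) State.init

/-- The cost of serving request `r` after the requests `σ`: `f w` for each time a size-`w` object is
written to an address (its initial allocation and all its moves, counted with multiplicity). -/
noncomputable def requestCost (ε : ℝ) (f : ℕ → ℝ) (σ : List (Request α)) (r : Request α) : ℝ :=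
  ((serve ε (stateAfter ε σ) r).2.map (fun c => f c.size)).sum

end StorageReallocation

/-!
A cell in a buffer, or in the tail buffer, was placed there first-fit: it did not fit into the
buffers of the smaller size classes from its own on, and still does not, since buffers do not lose
cells between two flushes. Hence a flush with boundary class `b` moves, for each class `k > b`, a
payload that can be charged to buffered cells: to buffer `k` if it is at least half full, and
otherwise to a cell beyond it that was rejected by it. Such a cell takes up more than half of the
buffer, so its class is within `lg (1 / ε) + O(1)` of `k`. Each buffered cell is thus charged by
`O(lg (1 / ε))` classes, at a rate of `O(1 / ε)` times its cost, and with `K` of the order of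
`(1 / ε) lg (1 / ε)`, the potential `K * (cost of the buffered cells) + (cost of the pending moves) +
(2 * K + 1) * (cost of the log)` gives the amortized bound.

For the worst case, a step of volume `v` costs at most `v * f 1` by subadditivity, and only the last
step performed during a request can exceed the budget `(4 / ε) * w`; this step costs at most `f Δ`.
-/

namespace StorageReallocation

universe u

variable {α : Type u} {f : ℕ → ℝ} {ε : ℝ}

/-! ### Cost functions -/

namespace IsCostFunction

lemma nonneg (hf : IsCostFunction f) {x : ℕ} (hx : 0 < x) : 0 ≤ f x := by
  have h_double : f 2 ≤ f 1 + f 1 := hf.subadd 1 1 one_pos one_pos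
  have h_two : f 1 ≤ f 2 := hf.mono 1 2 one_pos one_le_two
  have h_one : f 1 ≤ f x := hf.mono 1 x one_pos hx
  linarith

lemma map_mul_le (hf : IsCostFunction f) {n v : ℕ} (hn : 0 < n) (hv : 0 < v) :
    f (n * v) ≤ n * f v := by
  induction n, hn using Nat.le_induction with
  | base => simp
  | succ n hn ih =>
    calc f ((n + 1) * v) = f (n * v + v) := by rw [Nat.succ_mul]
      _ ≤ f (n * v) + f v := hf.subadd _ _ (Nat.mul_pos hn hv) hv
      _ ≤ (n + 1 : ℕ) * f v := by push_cast; linarith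

-- `x / v + 1` objects of length `v` are together at least as long as one of length `x`.
lemma mul_le_three_mul (hf : IsCostFunction f) {x v : ℕ} (hv : 0 < v) (hvx : v < 2 * x) :
    f x * v ≤ 3 * x * f v := by
  have h_cover : x ≤ (x / v + 1) * v := by
    have := Nat.lt_div_mul_add (a := x) hv
    linarith
  have h_length : (((x / v + 1 : ℕ) : ℝ)) * v ≤ 3 * x := by
    have := Nat.div_mul_le_self x v
    exact_mod_cast show (x / v + 1) * v ≤ 3 * x by linarith
  have h_cost : f x ≤ ((x / v + 1 : ℕ) : ℝ) * f v :=
    (hf.mono _ _ (by omega) h_cover).trans (hf.map_mul_le (Nat.succ_pos _) hv)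
  have := hf.nonneg hv
  calc f x * v ≤ ((x / v + 1 : ℕ) : ℝ) * f v * v := by gcongr
    _ = ((x / v + 1 : ℕ) : ℝ) * v * f v := by ring
    _ ≤ 3 * x * f v := by gcongr

end IsCostFunction

/-! ### Size classes -/

lemma sizeClass_mono : Monotone sizeClass := fun _ _ h => Nat.size_le_size h

lemma two_pow_sizeClass_le {x : ℕ} (hx : 0 < x) : 2 ^ sizeClass x ≤ 2 * x := by
  obtain ⟨k, hk⟩ := Nat.exists_eq_add_one_of_ne_zero (Nat.size_pos.2 hx).ne'
  have : 2 ^ k ≤ x := Nat.lt_size.1 (by omega)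
  rw [sizeClass, hk, pow_succ]
  omega

lemma lt_two_mul_of_sizeClass_le {v x : ℕ} (hx : 0 < x) (h : sizeClass v ≤ sizeClass x) :
    v < 2 * x :=
  (Nat.size_le.1 h).trans_le (two_pow_sizeClass_le hx)

/-! ### Lists of cells -/

/-- The cost of writing the objects of a list of cells. Holes and delete records count like objects,
so that the cost can also be used in potentials. -/
def cost (f : ℕ → ℝ) (l : List (Cell α)) : ℝ := (l.map fun c => f c.size).sum

@[simp] lemma vol_nil : vol ([] : List (Cell α)) = 0 := rfl

@[simp] lemma vol_cons (c : Cell α) (l : List (Cell α)) : vol (c :: l) = c.size + vol l := by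
  simp [vol]

@[simp] lemma vol_append (l l' : List (Cell α)) : vol (l ++ l') = vol l + vol l' := by
  simp [vol]

@[simp] lemma cost_nil (f : ℕ → ℝ) : cost f ([] : List (Cell α)) = 0 := rfl

@[simp] lemma cost_cons (f : ℕ → ℝ) (c : Cell α) (l : List (Cell α)) :
    cost f (c :: l) = f c.size + cost f l := by
  simp [cost]

@[simp] lemma cost_append (f : ℕ → ℝ) (l l' : List (Cell α)) :
    cost f (l ++ l') = cost f l + cost f l' := by
  simp [cost]

@[simp] lemma cost_reverse (f : ℕ → ℝ) (l : List (Cell α)) : cost f l.reverse = cost f l := by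
  simp [cost]

lemma cost_flatMap (f : ℕ → ℝ) (ks : List ℕ) (g : ℕ → List (Cell α)) :
    cost f (ks.flatMap g) = (ks.map fun k => cost f (g k)).sum := by
  induction ks with
  | nil => rfl
  | cons k ks ih => simp [ih]

lemma cost_congr {l l' : List (Cell α)} (f : ℕ → ℝ) (h : l.map Cell.size = l'.map Cell.size) :
    cost f l = cost f l' := by
  have cost_eq (l : List (Cell α)) : cost f l = ((l.map Cell.size).map f).sum := by
    rw [List.map_map]; rfl
  rw [cost_eq, cost_eq, h]

lemma vol_congr {l l' : List (Cell α)} (h : l.map Cell.size = l'.map Cell.size) :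
    vol l = vol l' := by
  rw [vol, vol, h]

lemma forall_size_of_map_subset {l l' : List (Cell α)} {p : ℕ → Prop}
    (h : l.map Cell.size ⊆ l'.map Cell.size) (hp : ∀ c ∈ l', p c.size) : ∀ c ∈ l, p c.size := by
  intro c hc
  obtain ⟨c', hc', hsize⟩ := List.mem_map.1 (h (List.mem_map_of_mem hc))
  exact hsize ▸ hp c' hc'

lemma map_size_layOut (s : ℕ) (l : List (Cell α)) :
    (layOut s l).map Cell.size = l.map Cell.size := by
  induction l generalizing s with
  | nil => rfl
  | cons c l ih => simp [layOut, ih]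

@[simp] lemma cost_layOut (f : ℕ → ℝ) (s : ℕ) (l : List (Cell α)) :
    cost f (layOut s l) = cost f l :=
  cost_congr f (map_size_layOut s l)

lemma cost_nonneg (hf : IsCostFunction f) {l : List (Cell α)} (hl : ∀ c ∈ l, 0 < c.size) :
    0 ≤ cost f l :=
  List.sum_nonneg (List.forall_mem_map.2 fun c hc => hf.nonneg (hl c hc))

lemma cost_le_of_sublist (hf : IsCostFunction f) {l l' : List (Cell α)} (hl' : ∀ c ∈ l', 0 < c.size)
    (h : l.Sublist l') : cost f l ≤ cost f l' :=
  (h.map _).sum_le_sum (List.forall_mem_map.2 fun c hc => hf.nonneg (hl' c hc))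

lemma le_cost_of_mem (hf : IsCostFunction f) {l : List (Cell α)} (hl : ∀ c ∈ l, 0 < c.size)
    {c : Cell α} (hc : c ∈ l) : f c.size ≤ cost f l := by
  simpa using cost_le_of_sublist hf hl (List.singleton_sublist.2 hc)

lemma eq_nil_of_vol_eq_zero {l : List (Cell α)} (hl : ∀ c ∈ l, 0 < c.size) (h : vol l = 0) :
    l = [] := by
  refine List.eq_nil_iff_forall_not_mem.2 fun c hc => ?_
  have : c.size ≤ vol l := List.le_sum_of_mem (List.mem_map_of_mem hc)
  have := hl c hc
  omega

/-- All cells have positive size at most `Δ`. -/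
def Sized (Δ : ℕ) (l : List (Cell α)) : Prop := ∀ c ∈ l, 0 < c.size ∧ c.size ≤ Δ

namespace Sized

variable {Δ : ℕ} {l l' : List (Cell α)}

lemma pos (h : Sized Δ l) : ∀ c ∈ l, 0 < c.size := fun c hc => (h c hc).1

lemma subset (h : Sized Δ l') (hl : l ⊆ l') : Sized Δ l := fun c hc => h c (hl hc)

lemma mono (h : Sized Δ l) {Δ' : ℕ} (hΔ : Δ ≤ Δ') : Sized Δ' l :=
  fun c hc => ⟨(h c hc).1, (h c hc).2.trans hΔ⟩

lemma nil : Sized Δ ([] : List (Cell α)) := List.forall_mem_nil _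

lemma singleton {c : Cell α} (hc : 0 < c.size) (hcΔ : c.size ≤ Δ) : Sized Δ [c] :=
  List.forall_mem_singleton.2 ⟨hc, hcΔ⟩

lemma append (h : Sized Δ l) (h' : Sized Δ l') : Sized Δ (l ++ l') :=
  List.forall_mem_append.2 ⟨h, h'⟩

lemma flatMap {ks : List ℕ} {g : ℕ → List (Cell α)} (h : ∀ k, Sized Δ (g k)) :
    Sized Δ (ks.flatMap g) := by
  intro c hc
  obtain ⟨k, -, hk⟩ := List.mem_flatMap.1 hc
  exact h k c hk

lemma of_map_size_subset (h : Sized Δ l') (hl : l.map Cell.size ⊆ l'.map Cell.size) : Sized Δ l :=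
  forall_size_of_map_subset (p := fun w => 0 < w ∧ w ≤ Δ) hl h

lemma layOut (h : Sized Δ l) (s : ℕ) : Sized Δ (layOut s l) :=
  h.of_map_size_subset (List.Perm.of_eq (map_size_layOut s l)).subset

end Sized

/-! ### Charging moves to updates -/

lemma sum_cost_filter_le {l : List (Cell α)} (hl : ∀ c ∈ l, 0 ≤ f c.size) (s : Finset ℕ)
    (r : ℕ → Cell α → Bool) {n : ℕ} (hr : ∀ c ∈ l, (s.filter fun k => r k c).card ≤ n) :
    ∑ k ∈ s, cost f (l.filter (r k)) ≤ n * cost f l := by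
  induction l with
  | nil => simp
  | cons c l ih =>
    rw [List.forall_mem_cons] at hl hr
    have filter_cons (k : ℕ) : cost f ((c :: l).filter (r k))
        = (if r k c then f c.size else 0) + cost f (l.filter (r k)) := by
      by_cases hk : r k c <;> simp [hk]
    have h_head : ∑ k ∈ s, (if r k c then f c.size else 0) ≤ n * f c.size := by
      rw [← Finset.sum_filter, Finset.sum_const, nsmul_eq_mul]
      exact mul_le_mul_of_nonneg_right (mod_cast hr.1) hl.1
    simp only [filter_cons, Finset.sum_add_distrib, cost_cons, mul_add]
    exact add_le_add h_head (ih hl.2 hr.2)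

lemma sum_cost_ofClass_le {l : List (Cell α)} (hl : ∀ c ∈ l, 0 ≤ f c.size) (s : Finset ℕ) :
    ∑ k ∈ s, cost f (ofClass k l) ≤ cost f l := by
  refine (sum_cost_filter_le hl s _ (n := 1) fun c _ => Finset.card_le_one.2 ?_).trans_eq (by simp)
  simp +contextual [eq_comm]

/-- The cells that can pay for moving a payload segment of size class `k`: their size classes are
among `k - m, …, k`. -/
def chargeable (m k : ℕ) (l : List (Cell α)) : List (Cell α) :=
  l.filter fun c => sizeClass c.size ≤ k ∧ k ≤ sizeClass c.size + m

lemma sum_cost_chargeable_le {l : List (Cell α)} (hl : ∀ c ∈ l, 0 ≤ f c.size) (s : Finset ℕ)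
    (m : ℕ) : ∑ k ∈ s, cost f (chargeable m k l) ≤ (m + 1) * cost f l := by
  refine (sum_cost_filter_le hl s _ (n := m + 1) fun c _ => ?_).trans_eq (by push_cast; rfl)
  have h_sub : (s.filter fun k => decide (sizeClass c.size ≤ k ∧ k ≤ sizeClass c.size + m))
      ⊆ Finset.Icc (sizeClass c.size) (sizeClass c.size + m) := fun k hk => by
    simpa using (Finset.mem_filter.1 hk).2
  refine (Finset.card_le_card h_sub).trans ?_
  rw [Nat.card_Icc]
  omega

lemma mul_vol_le (hf : IsCostFunction f) {x : ℕ} {q : List (Cell α)}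
    (hq : ∀ d ∈ q, 0 < d.size) (hxq : ∀ d ∈ q, d.size < 2 * x) :
    f x * vol q ≤ 3 * x * cost f q := by
  induction q with
  | nil => simp
  | cons d q ih =>
    rw [List.forall_mem_cons] at hq hxq
    have h_head := hf.mul_le_three_mul hq.1 hxq.1
    have h_tail := ih hq.2 hxq.2
    rw [cost_cons, vol_cons]
    push_cast
    linarith

lemma cost_mul_vol_le (hf : IsCostFunction f) {p q : List (Cell α)} (hq : ∀ d ∈ q, 0 < d.size)
    (hpq : ∀ c ∈ p, ∀ d ∈ q, d.size < 2 * c.size) :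
    cost f p * vol q ≤ 3 * vol p * cost f q := by
  induction p with
  | nil => simp
  | cons c p ih =>
    rw [List.forall_mem_cons] at hpq
    have h_head := mul_vol_le hf hq hpq.1
    have h_tail := ih hpq.2
    rw [cost_cons, vol_cons]
    push_cast
    linarith

lemma cost_le_of_mul_vol_le (hf : IsCostFunction f) (hε : 0 < ε) {p q : List (Cell α)}
    (hp : ∀ c ∈ p, 0 < c.size) (hq : ∀ d ∈ q, 0 < d.size)
    (hpq : ∀ c ∈ p, ∀ d ∈ q, d.size < 2 * c.size) (h : ε * vol p ≤ 2 * vol q) :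
    cost f p ≤ 6 / ε * cost f q := by
  have hcp : 0 ≤ cost f p := cost_nonneg hf hp
  have hcq : 0 ≤ cost f q := cost_nonneg hf hq
  rcases (vol p).eq_zero_or_pos with hp0 | hp0
  · rw [eq_nil_of_vol_eq_zero hp hp0, cost_nil]
    positivity
  have h_scaled : cost f p * ε * vol p ≤ 6 * cost f q * vol p :=
    calc cost f p * ε * vol p = cost f p * (ε * vol p) := by ring
      _ ≤ cost f p * (2 * vol q) := by gcongr
      _ ≤ 6 * cost f q * vol p := by linarith [cost_mul_vol_le hf hq hpq]
  rw [div_mul_eq_mul_div, le_div_iff₀ hε]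
  exact le_of_mul_le_mul_right h_scaled (by exact_mod_cast hp0)

lemma sizeClass_le_of_mul_lt (hε : 0 < ε) {x w m : ℕ} (hx : 0 < x) (h : ε * x < 2 * w)
    (hm : 1 / ε ≤ 2 ^ m) : sizeClass x ≤ sizeClass w + (m + 1) := by
  have h_lower : (2 : ℝ) ^ sizeClass x ≤ 2 * x := by exact_mod_cast two_pow_sizeClass_le hx
  have h_upper : (w : ℝ) ≤ 2 ^ sizeClass w := by exact_mod_cast (Nat.lt_size_self w).le
  have h_pow : (2 : ℝ) ^ sizeClass x < 2 ^ (sizeClass w + (m + 2)) :=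
    calc (2 : ℝ) ^ sizeClass x ≤ 1 / ε * (2 * (ε * x)) := by field_simp; linarith
      _ < 1 / ε * (2 * (2 * w)) := by gcongr
      _ ≤ 2 ^ m * (2 * (2 * 2 ^ sizeClass w)) := by gcongr
      _ = 2 ^ (sizeClass w + (m + 2)) := by ring
  have := (pow_lt_pow_iff_right₀ one_lt_two).1 h_pow
  omega

/-! ### Regions -/

namespace Region

/-- A cell of size `w` fits into the unoccupied space of the buffer of the region. -/
def Fits (R : Region α) (w : ℕ) : Prop := vol R.buffer + w ≤ R.bufSpace

/-- The invariant of the region of size class `k` while the longest object so far has length `Δ`. -/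
structure WellFormed (ε : ℝ) (Δ k : ℕ) (R : Region α) : Prop where
  bufSpace_eq : R.bufSpace = ⌊ε * (R.paySpace : ℝ)⌋₊
  vol_payload_le : vol R.payload ≤ R.paySpace
  vol_buffer_le : vol R.buffer ≤ R.bufSpace
  sizeClass_payload : ∀ c ∈ R.payload, sizeClass c.size = k
  sizeClass_buffer : ∀ c ∈ R.buffer, sizeClass c.size ≤ k
  sized_payload : Sized Δ R.payload
  sized_buffer : Sized Δ R.buffer
  paySpace_eq_zero : sizeClass Δ < k → R.paySpace = 0

/-- `R'` arises from `R` by operations that neither move segment boundaries nor create space in the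
buffer: objects are removed from or moved within the payload, and buffered objects become holes. -/
structure IsThinning (R' R : Region α) : Prop where
  paySpace_eq : R'.paySpace = R.paySpace
  bufSpace_eq : R'.bufSpace = R.bufSpace
  payload_sublist : (R'.payload.map Cell.size).Sublist (R.payload.map Cell.size)
  buffer_eq : R'.buffer.map Cell.size = R.buffer.map Cell.size

variable {Δ k : ℕ} {R R' : Region α}

protected lemma IsThinning.refl (R : Region α) : R.IsThinning R := ⟨rfl, rfl, .refl _, rfl⟩

protected lemma IsThinning.trans {R'' : Region α} (h : R''.IsThinning R') (h' : R'.IsThinning R) :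
    R''.IsThinning R :=
  ⟨h.paySpace_eq.trans h'.paySpace_eq, h.bufSpace_eq.trans h'.bufSpace_eq,
    h.payload_sublist.trans h'.payload_sublist, h.buffer_eq.trans h'.buffer_eq⟩

lemma IsThinning.fits_iff (hR' : R'.IsThinning R) {w : ℕ} : R'.Fits w ↔ R.Fits w := by
  rw [Fits, Fits, vol_congr hR'.buffer_eq, hR'.bufSpace_eq]

namespace WellFormed

lemma mono (h : R.WellFormed ε Δ k) {Δ' : ℕ} (hΔ : Δ ≤ Δ') : R.WellFormed ε Δ' k :=
  { h with
    sized_payload := h.sized_payload.mono hΔ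
    sized_buffer := h.sized_buffer.mono hΔ
    paySpace_eq_zero := fun hk => h.paySpace_eq_zero ((sizeClass_mono hΔ).trans_lt hk) }

lemma of_isThinning (h : R.WellFormed ε Δ k) (hR' : R'.IsThinning R) : R'.WellFormed ε Δ k where
  bufSpace_eq := by rw [hR'.bufSpace_eq, hR'.paySpace_eq, h.bufSpace_eq]
  vol_payload_le := by
    rw [hR'.paySpace_eq]
    exact hR'.payload_sublist.sum_le_sum (by simp) |>.trans h.vol_payload_le
  vol_buffer_le := by rw [vol_congr hR'.buffer_eq, hR'.bufSpace_eq]; exact h.vol_buffer_le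
  sizeClass_payload :=
    forall_size_of_map_subset (p := fun w => sizeClass w = k) hR'.payload_sublist.subset
      h.sizeClass_payload
  sizeClass_buffer :=
    forall_size_of_map_subset (p := fun w => sizeClass w ≤ k)
      (List.Perm.of_eq hR'.buffer_eq).subset h.sizeClass_buffer
  sized_payload := h.sized_payload.of_map_size_subset hR'.payload_sublist.subset
  sized_buffer := h.sized_buffer.of_map_size_subset (List.Perm.of_eq hR'.buffer_eq).subset
  paySpace_eq_zero := fun hk => hR'.paySpace_eq.trans (h.paySpace_eq_zero hk)

lemma bufSpace_eq_zero (h : R.WellFormed ε Δ k) (hR : R.paySpace = 0) : R.bufSpace = 0 := by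
  simp [h.bufSpace_eq, hR]

lemma buffer_eq_nil (h : R.WellFormed ε Δ k) (hR : R.paySpace = 0) : R.buffer = [] :=
  eq_nil_of_vol_eq_zero h.sized_buffer.pos
    (Nat.le_zero.1 (h.vol_buffer_le.trans_eq (h.bufSpace_eq_zero hR)))

lemma not_fits (h : R.WellFormed ε Δ k) (hR : R.paySpace = 0) {w : ℕ} (hw : 0 < w) :
    ¬ R.Fits w := by
  rw [Fits, h.bufSpace_eq_zero hR]
  omega

lemma append_buffer (h : R.WellFormed ε Δ k) {c : Cell α} (hc : 0 < c.size) (hcΔ : c.size ≤ Δ)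
    (hck : sizeClass c.size ≤ k) (hfits : R.Fits c.size) :
    WellFormed ε Δ k { R with buffer := R.buffer ++ [c] } :=
  { h with
    vol_buffer_le := by simpa [Fits] using hfits
    sizeClass_buffer := List.forall_mem_append.2 ⟨h.sizeClass_buffer, by simpa using hck⟩
    sized_buffer := h.sized_buffer.append (.singleton hc hcΔ) }

lemma lt_of_not_fits (h : R.WellFormed ε Δ k) (hε : 0 < ε) {w : ℕ} (hw : ¬ R.Fits w) :
    ε * vol R.payload < vol R.buffer + w := by
  rw [Fits, not_le, h.bufSpace_eq, Nat.floor_lt (by positivity)] at hw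
  have : (vol R.payload : ℝ) ≤ R.paySpace := by exact_mod_cast h.vol_payload_le
  calc ε * vol R.payload ≤ ε * R.paySpace := by gcongr
    _ < vol R.buffer + w := by exact_mod_cast hw

-- Either the buffer is at least half full, or the skipped cell alone is as long as half the buffer.
lemma cost_payload_le (h : R.WellFormed ε Δ k) (hf : IsCostFunction f) (hε : 0 < ε) {m : ℕ}
    (hm : 1 / ε ≤ 2 ^ m) {l : List (Cell α)} (hl : ∀ c ∈ l, 0 < c.size) {c : Cell α} (hc : c ∈ l)
    (hck : sizeClass c.size ≤ k) (hskip : ¬ R.Fits c.size) :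
    cost f R.payload ≤ 6 / ε * (cost f R.buffer + cost f (chargeable (m + 1) k l)) := by
  have size_lt {c d : Cell α} (hc : c ∈ R.payload) (hd : sizeClass d.size ≤ k) :
      d.size < 2 * c.size :=
    lt_two_mul_of_sizeClass_le (h.sized_payload.pos c hc) (hd.trans (h.sizeClass_payload c hc).ge)
  have h_buffer : 0 ≤ cost f R.buffer := cost_nonneg hf h.sized_buffer.pos
  have hl_chargeable : ∀ d ∈ chargeable (m + 1) k l, 0 < d.size :=
    fun d hd => hl d (List.mem_of_mem_filter hd)
  have h_chargeable : 0 ≤ cost f (chargeable (m + 1) k l) := cost_nonneg hf hl_chargeable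
  rcases le_or_gt (ε * vol R.payload) (2 * vol R.buffer) with h_half | h_half
  · calc cost f R.payload ≤ 6 / ε * cost f R.buffer :=
          cost_le_of_mul_vol_le hf hε h.sized_payload.pos h.sized_buffer.pos
            (fun c hc d hd => size_lt hc (h.sizeClass_buffer d hd)) h_half
      _ ≤ 6 / ε * (cost f R.buffer + cost f (chargeable (m + 1) k l)) := by
          gcongr; linarith
  have h_short : ε * vol R.payload < 2 * c.size := by linarith [h.lt_of_not_fits hε hskip]
  by_cases h_nil : R.payload = []
  · rw [h_nil, cost_nil]
    positivity
  obtain ⟨x, hx⟩ := List.exists_mem_of_ne_nil _ h_nil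
  have h_class : k ≤ sizeClass c.size + (m + 1) := by
    have hx_vol : (x.size : ℝ) ≤ vol R.payload := by
      exact_mod_cast List.le_sum_of_mem (List.mem_map_of_mem hx)
    rw [← h.sizeClass_payload x hx]
    refine sizeClass_le_of_mul_lt hε (h.sized_payload.pos x hx) (lt_of_le_of_lt ?_ h_short) hm
    gcongr
  have hc_mem : c ∈ chargeable (m + 1) k l := List.mem_filter.2 ⟨hc, by simp [hck, h_class]⟩
  calc cost f R.payload ≤ 6 / ε * cost f [c] :=
        cost_le_of_mul_vol_le hf hε h.sized_payload.pos (by simpa using hl c hc)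
          (fun d hd => by simpa using size_lt hd hck) (by simpa using h_short.le)
    _ ≤ 6 / ε * (cost f R.buffer + cost f (chargeable (m + 1) k l)) := by
        have := le_cost_of_mem hf hl_chargeable hc_mem
        rw [cost_cons, cost_nil, add_zero]
        gcongr
        linarith

end WellFormed

end Region

/-! ### Layouts -/

namespace Layout

variable {D D' : Layout α}

lemma mem_classesFrom {b k : ℕ} : k ∈ D.classesFrom b ↔ k ≤ D.numClasses ∧ b ≤ k := by
  simp [classesFrom]

lemma sum_map_classesFrom (D : Layout α) (b : ℕ) (g : ℕ → ℝ) :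
    ((D.classesFrom b).map g).sum = ∑ k ∈ Finset.Icc b D.numClasses, g k := by
  have h_nodup : (D.classesFrom b).Nodup := List.nodup_range.filter _
  rw [← List.sum_toFinset g h_nodup]
  refine Finset.sum_congr (Finset.ext fun k => ?_) fun _ _ => rfl
  rw [List.mem_toFinset, mem_classesFrom, Finset.mem_Icc, and_comm]

/-- Everything stored in the buffers `i ≥ b`, the tail buffer included: objects, holes and delete
records. -/
def bufferCells (D : Layout α) (b : ℕ) : List (Cell α) :=
  (D.classesFrom b).flatMap (fun k => (D.region k).buffer) ++ D.tail

/-- The cost of moving everything in the buffers once. -/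
def bufferCost (f : ℕ → ℝ) (D : Layout α) : ℝ := cost f (D.bufferCells 0)

lemma cost_bufferCells (f : ℕ → ℝ) (D : Layout α) (b : ℕ) :
    cost f (D.bufferCells b)
      = ∑ k ∈ Finset.Icc b D.numClasses, cost f (D.region k).buffer + cost f D.tail := by
  rw [bufferCells, cost_append, cost_flatMap, sum_map_classesFrom]

lemma buffered_eq_liveCells (D : Layout α) (b : ℕ) :
    D.buffered b = liveCells (D.bufferCells b) := by
  simp only [buffered, bufferCells, liveCells, List.filter_append, List.filter_flatMap]

/-- The layout in which size class `j` has the region `R`. -/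
def setRegion (D : Layout α) (j : ℕ) (R : Region α) : Layout α :=
  { D with region := Function.update D.region j R }

lemma bufferCost_setRegion_add (f : ℕ → ℝ) (D : Layout α) {j : ℕ} (hj : j ≤ D.numClasses)
    (R : Region α) : (D.setRegion j R).bufferCost f + cost f (D.region j).buffer
      = D.bufferCost f + cost f R.buffer := by
  have hj_mem : j ∈ Finset.Icc 0 D.numClasses := Finset.mem_Icc.2 ⟨j.zero_le, hj⟩
  have h_update (k : ℕ) : cost f ((D.setRegion j R).region k).buffer
      = Function.update (fun k => cost f (D.region k).buffer) j (cost f R.buffer) k :=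
    Function.apply_update (fun _ (R : Region α) => cost f R.buffer) D.region j R k
  simp only [bufferCost, cost_bufferCells, h_update]
  change ∑ k ∈ Finset.Icc 0 D.numClasses, _ + cost f D.tail + _ = _
  rw [Finset.sum_update_of_mem hj_mem, Finset.sdiff_singleton_eq_erase,
    ← Finset.add_sum_erase _ (fun k => cost f (D.region k).buffer) hj_mem]
  ring

lemma bufferCost_append_tail (f : ℕ → ℝ) (D : Layout α) (c : Cell α) :
    bufferCost f { D with tail := D.tail ++ [c] } = D.bufferCost f + f c.size := by
  have : cost f [c] = f c.size := by simp
  rw [bufferCost, bufferCost, ← this, ← cost_append, bufferCells, bufferCells, List.append_assoc]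
  rfl

/-- The same layout after an object of length `m` has been seen. -/
def withMaxLen (D : Layout α) (m : ℕ) : Layout α := { D with maxLen := m }

/-- A cell of size `w` fits into none of the buffers that may hold it, the tail buffer aside. -/
def Rejects (D : Layout α) (w : ℕ) : Prop := ∀ k, sizeClass w ≤ k → ¬ (D.region k).Fits w

/-- The invariant of the array. The last two clauses hold since buffers fill up first-fit, and do
not lose any cells between two flushes. -/
structure WellFormed (ε : ℝ) (D : Layout α) : Prop where
  region : ∀ k, (D.region k).WellFormed ε D.maxLen k
  sized_tail : Sized D.maxLen D.tail
  skip_buffer : ∀ j, ∀ c ∈ (D.region j).buffer, ∀ k, sizeClass c.size ≤ k → k < j →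
    ¬ (D.region k).Fits c.size
  skip_tail : ∀ c ∈ D.tail, D.Rejects c.size

/-- `D'` arises from `D` by turning buffered objects into holes and removing or moving payload
objects. -/
structure IsThinning (D' D : Layout α) : Prop where
  maxLen_eq : D'.maxLen = D.maxLen
  region : ∀ k, (D'.region k).IsThinning (D.region k)
  tail_eq : D'.tail.map Cell.size = D.tail.map Cell.size

protected lemma IsThinning.refl (D : Layout α) : D.IsThinning D :=
  ⟨rfl, fun _ => .refl _, rfl⟩

protected lemma IsThinning.trans {D'' : Layout α} (h : D''.IsThinning D') (h' : D'.IsThinning D) :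
    D''.IsThinning D :=
  ⟨h.maxLen_eq.trans h'.maxLen_eq, fun k => (h.region k).trans (h'.region k),
    h.tail_eq.trans h'.tail_eq⟩

lemma IsThinning.bufferCost_eq (hD' : D'.IsThinning D) (f : ℕ → ℝ) :
    D'.bufferCost f = D.bufferCost f := by
  have h_buffer (k : ℕ) := cost_congr f (hD'.region k).buffer_eq
  simp only [bufferCost, cost_bufferCells, numClasses, hD'.maxLen_eq, h_buffer,
    cost_congr f hD'.tail_eq]

lemma isThinning_relocate (D : Layout α) [DecidableEq α] (m : Cell α) :
    (D.relocate m).IsThinning D where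
  maxLen_eq := rfl
  region k :=
    { paySpace_eq := rfl
      bufSpace_eq := rfl
      payload_sublist := by
        simp [relocate, Function.comp_def, apply_ite Cell.size]
      buffer_eq := rfl }
  tail_eq := rfl

lemma isThinning_remove (D : Layout α) [DecidableEq α] (x : α) : (D.remove x).IsThinning D where
  maxLen_eq := rfl
  region k :=
    { paySpace_eq := rfl
      bufSpace_eq := rfl
      payload_sublist := List.filter_sublist.map _
      buffer_eq := by
        simp [remove, apply_ite Cell.size] }
  tail_eq := by simp [remove, apply_ite Cell.size]

namespace WellFormed

lemma of_isThinning (h : D.WellFormed ε) (hD' : D'.IsThinning D) : D'.WellFormed ε where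
  region k := hD'.maxLen_eq ▸ (h.region k).of_isThinning (hD'.region k)
  sized_tail := hD'.maxLen_eq ▸ h.sized_tail.of_map_size_subset (List.Perm.of_eq hD'.tail_eq).subset
  skip_buffer j := by
    simp only [fun k w => (hD'.region k).fits_iff (w := w)]
    exact forall_size_of_map_subset (p := fun w => ∀ k, sizeClass w ≤ k → k < j →
      ¬ (D.region k).Fits w) (List.Perm.of_eq (hD'.region j).buffer_eq).subset (h.skip_buffer j)
  skip_tail := by
    simp only [Rejects, fun k w => (hD'.region k).fits_iff (w := w)]
    exact forall_size_of_map_subset (List.Perm.of_eq hD'.tail_eq).subset h.skip_tail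

lemma withMaxLen (h : D.WellFormed ε) {m : ℕ} (hm : D.maxLen ≤ m) :
    (D.withMaxLen m).WellFormed ε :=
  { h with
    region := fun k => (h.region k).mono hm
    sized_tail := h.sized_tail.mono hm }

lemma paySpace_eq_zero (h : D.WellFormed ε) {k : ℕ} (hk : D.numClasses < k) :
    (D.region k).paySpace = 0 :=
  (h.region k).paySpace_eq_zero hk

lemma bufferCost_withMaxLen (h : D.WellFormed ε) {m : ℕ} (hm : D.maxLen ≤ m) (f : ℕ → ℝ) :
    (D.withMaxLen m).bufferCost f = D.bufferCost f := by
  rw [bufferCost, bufferCost, cost_bufferCells, cost_bufferCells]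
  congr 1
  refine (Finset.sum_subset (Finset.Icc_subset_Icc_right (sizeClass_mono hm)) ?_).symm
  intro k _ hk
  have hk : D.numClasses < k := by
    simp only [Finset.mem_Icc, k.zero_le, true_and, not_le] at hk
    exact hk
  exact congrArg (cost f) ((h.region k).buffer_eq_nil (h.paySpace_eq_zero hk))

lemma sized_bufferCells (h : D.WellFormed ε) (b : ℕ) : Sized D.maxLen (D.bufferCells b) :=
  (Sized.flatMap fun k => (h.region k).sized_buffer).append h.sized_tail

lemma sized_buffered (h : D.WellFormed ε) (b : ℕ) : Sized D.maxLen (D.buffered b) := by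
  rw [buffered_eq_liveCells]
  exact (h.sized_bufferCells b).subset (List.filter_subset_self _)

lemma bufferCost_nonneg (h : D.WellFormed ε) (hf : IsCostFunction f) : 0 ≤ D.bufferCost f :=
  cost_nonneg hf (h.sized_bufferCells 0).pos

lemma setRegion (h : D.WellFormed ε) {j : ℕ} {R : Region α} (hR : R.WellFormed ε D.maxLen j)
    (h_skip : ∀ c ∈ R.buffer, ∀ k, sizeClass c.size ≤ k → k < j → ¬ (D.region k).Fits c.size)
    (h_later : ∀ l, j < l → ∀ c ∈ (D.region l).buffer, sizeClass c.size ≤ j → ¬ R.Fits c.size)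
    (h_tail : ∀ c ∈ D.tail, sizeClass c.size ≤ j → ¬ R.Fits c.size) :
    (D.setRegion j R).WellFormed ε := by
  have region_self : (D.setRegion j R).region j = R := Function.update_self _ _ _
  have region_of_ne {k : ℕ} (hk : k ≠ j) : (D.setRegion j R).region k = D.region k :=
    Function.update_of_ne hk _ _
  refine ⟨fun k => ?_, h.sized_tail, fun l c hc k hck hkl => ?_, fun c hc k hck => ?_⟩
  · rcases eq_or_ne k j with rfl | hk
    · rwa [region_self]
    · rw [region_of_ne hk]; exact h.region k
  · rcases eq_or_ne k j with rfl | hk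
    · rw [region_of_ne hkl.ne'] at hc
      rw [region_self]; exact h_later l hkl c hc hck
    rw [region_of_ne hk]
    rcases eq_or_ne l j with rfl | hl
    · exact h_skip c (region_self ▸ hc) k hck hkl
    · exact h.skip_buffer l c (region_of_ne hl ▸ hc) k hck hkl
  · rcases eq_or_ne k j with rfl | hk
    · rw [region_self]; exact h_tail c hc hck
    · rw [region_of_ne hk]; exact h.skip_tail c hc k hck

lemma append_buffer (h : D.WellFormed ε) {c : Cell α} (hc : 0 < c.size) (hcΔ : c.size ≤ D.maxLen)
    {j : ℕ} (hcj : sizeClass c.size ≤ j) (hfits : (D.region j).Fits c.size)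
    (h_skip : ∀ k, sizeClass c.size ≤ k → k < j → ¬ (D.region k).Fits c.size) :
    (D.setRegion j { D.region j with buffer := (D.region j).buffer ++ [c] }).WellFormed ε := by
  have fits_of_append {w : ℕ}
      (hw : Region.Fits { D.region j with buffer := (D.region j).buffer ++ [c] } w) :
      (D.region j).Fits w := by
    simp only [Region.Fits, vol_append] at hw ⊢
    omega
  refine h.setRegion ((h.region j).append_buffer hc hcΔ hcj hfits) ?_ ?_ ?_
  · exact List.forall_mem_append.2 ⟨h.skip_buffer j, List.forall_mem_singleton.2 h_skip⟩
  · exact fun l hl d hd hdj hw => h.skip_buffer l d hd j hdj hl (fits_of_append hw)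
  · exact fun d hd hdj hw => h.skip_tail d hd j hdj (fits_of_append hw)

lemma append_tail (h : D.WellFormed ε) {c : Cell α} (hc : 0 < c.size) (hcΔ : c.size ≤ D.maxLen)
    (h_rejects : D.Rejects c.size) : WellFormed ε { D with tail := D.tail ++ [c] } :=
  { h with
    sized_tail := h.sized_tail.append (.singleton hc hcΔ)
    skip_tail := List.forall_mem_append.2 ⟨h.skip_tail, List.forall_mem_singleton.2 h_rejects⟩ }

lemma rejects_of_forall_classesFrom (h : D.WellFormed ε) {w : ℕ} (hw : 0 < w)
    (h_all : ∀ k ∈ D.classesFrom (sizeClass w), ¬ (D.region k).Fits w) : D.Rejects w := by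
  intro k hk
  rcases le_or_gt k D.numClasses with hk' | hk'
  · exact h_all k (mem_classesFrom.2 ⟨hk', hk⟩)
  · exact (h.region k).not_fits (h.paySpace_eq_zero hk') hw

end WellFormed

/-- The layout `D₁` arises from `D` by writing a cell of size `w` somewhere. -/
structure Records (ε : ℝ) (D : Layout α) (w : ℕ) (D₁ : Layout α) : Prop where
  wellFormed : D₁.WellFormed ε
  maxLen_eq : D₁.maxLen = D.maxLen
  bufferCost_le : ∀ f, IsCostFunction f → D₁.bufferCost f ≤ D.bufferCost f + f w

lemma Records.of_isThinning {D₁ : Layout α} {w : ℕ} (h : Records ε D' w D₁)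
    (hD' : D'.IsThinning D) : Records ε D w D₁ where
  wellFormed := h.wellFormed
  maxLen_eq := h.maxLen_eq.trans hD'.maxLen_eq
  bufferCost_le f hf := hD'.bufferCost_eq f ▸ h.bufferCost_le f hf

lemma WellFormed.records_append_tail (h : D.WellFormed ε) {c : Cell α} (hc : 0 < c.size)
    (hcΔ : c.size ≤ D.maxLen) (h_rejects : D.Rejects c.size) :
    Records ε D c.size { D with tail := D.tail ++ [c] } :=
  ⟨h.append_tail hc hcΔ h_rejects, rfl, fun f _ => (bufferCost_append_tail f D c).le⟩

lemma WellFormed.records_append_buffer (h : D.WellFormed ε) {c : Cell α} (hc : 0 < c.size)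
    (hcΔ : c.size ≤ D.maxLen) {j : ℕ} (hcj : sizeClass c.size ≤ j) (hj : j ≤ D.numClasses)
    (hfits : (D.region j).Fits c.size)
    (h_skip : ∀ k, sizeClass c.size ≤ k → k < j → ¬ (D.region k).Fits c.size) :
    Records ε D c.size
      (D.setRegion j { D.region j with buffer := (D.region j).buffer ++ [c] }) := by
  refine ⟨h.append_buffer hc hcΔ hcj hfits h_skip, rfl, fun f _ => le_of_eq ?_⟩
  have := bufferCost_setRegion_add f D hj
    { D.region j with buffer := (D.region j).buffer ++ [c] }
  rw [cost_append, cost_cons, cost_nil] at this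
  linarith

lemma WellFormed.rejects_of_store_eq_none (h : D.WellFormed ε) {x : α} {w : ℕ} {live : Bool}
    (hw : 0 < w) (h_store : D.store x w live = none) : D.Rejects w := by
  unfold store at h_store
  split at h_store
  · cases h_store
  · next h_find =>
    exact h.rejects_of_forall_classesFrom hw fun k hk => by
      simpa [Region.Fits] using List.find?_eq_none.1 h_find k hk

lemma size_eq_of_store_eq_some {x : α} {w : ℕ} {live : Bool} {c : Cell α}
    (h_store : D.store x w live = some (D', c)) : c.size = w := by
  unfold store at h_store
  split at h_store
  · exact congrArg (Cell.size ∘ Prod.snd) (Option.some.inj h_store).symm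
  · split_ifs at h_store
    exact congrArg (Cell.size ∘ Prod.snd) (Option.some.inj h_store).symm

lemma WellFormed.records_of_store_eq_some (h : D.WellFormed ε) {x : α} {w : ℕ} {live : Bool}
    {c : Cell α} (hw : 0 < w) (hwΔ : w ≤ D.maxLen) (h_store : D.store x w live = some (D', c)) :
    Records ε D w D' := by
  unfold store at h_store
  split at h_store
  · next j h_find =>
    rw [classesFrom, List.find?_filter, List.find?_range_eq_some] at h_find
    obtain ⟨h_fits, hj, h_first⟩ := h_find
    obtain ⟨rfl, rfl⟩ := Prod.mk.inj (Option.some.inj h_store)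
    simp only [decide_eq_true_eq] at h_fits
    refine h.records_append_buffer (c := ⟨x, w, _, live⟩) hw hwΔ h_fits.1
      (by simpa [Nat.lt_succ_iff] using hj) h_fits.2 fun k hk hkj => ?_
    simpa [hk, Region.Fits] using h_first k hkj
  · next h_find =>
    have h_rejects : D.Rejects w := h.rejects_of_forall_classesFrom hw fun k hk => by
      simpa [Region.Fits] using List.find?_eq_none.1 h_find k hk
    split_ifs at h_store
    obtain ⟨rfl, rfl⟩ := Prod.mk.inj (Option.some.inj h_store)
    exact h.records_append_tail (c := ⟨x, w, _, live⟩) hw hwΔ h_rejects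

end Layout

/-! ### The boundary and the target of a flush -/

lemma Region.WellFormed.flush {Δ k : ℕ} {R : Region α} (h : R.WellFormed ε Δ k) {l : List (Cell α)}
    (hl : Sized Δ l) :
    Region.WellFormed ε Δ k
      { payload := R.payload ++ ofClass k l
        paySpace := vol (R.payload ++ ofClass k l)
        buffer := []
        bufSpace := ⌊ε * (vol (R.payload ++ ofClass k l) : ℝ)⌋₊ } where
  bufSpace_eq := rfl
  vol_payload_le := le_rfl
  vol_buffer_le := Nat.zero_le _
  sizeClass_payload :=
    List.forall_mem_append.2 ⟨h.sizeClass_payload, fun c hc => by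
      simpa using (List.mem_filter.1 hc).2⟩
  sizeClass_buffer := List.forall_mem_nil _
  sized_payload := h.sized_payload.append (hl.subset (List.filter_subset_self _))
  sized_buffer := .nil
  paySpace_eq_zero hk := by
    have h_payload : vol R.payload = 0 :=
      Nat.le_zero.1 (h.vol_payload_le.trans_eq (h.paySpace_eq_zero hk))
    have h_class : ofClass k l = [] := List.filter_eq_nil_iff.2 fun c hc => by
      simpa using ((sizeClass_mono (hl c hc).2).trans_lt hk).ne
    simp only [vol_append, h_payload, h_class, vol_nil, add_zero]

namespace Layout

variable {D : Layout α}

lemma WellFormed.target (h : D.WellFormed ε) (b : ℕ) : (D.target ε b).WellFormed ε where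
  region k := by
    by_cases hk : b ≤ k
    · simpa only [Layout.target, if_pos hk] using (h.region k).flush (h.sized_buffered b)
    · simpa only [Layout.target, if_neg hk] using h.region k
  sized_tail := .nil
  skip_buffer j c hc k hck hkj := by
    by_cases hj : b ≤ j
    · simp only [Layout.target, if_pos hj, List.not_mem_nil] at hc
    · have hk : ¬ b ≤ k := by omega
      simp only [Layout.target, if_neg hj] at hc
      simpa only [Layout.target, if_neg hk] using h.skip_buffer j c hc k hck hkj
  skip_tail := List.forall_mem_nil _

lemma bufferCost_eq_target_add (f : ℕ → ℝ) (ε : ℝ) (D : Layout α) (b : ℕ) :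
    D.bufferCost f = (D.target ε b).bufferCost f + cost f (D.bufferCells b) := by
  have h_buffer (k : ℕ) : cost f ((D.target ε b).region k).buffer
      = if b ≤ k then 0 else cost f (D.region k).buffer := by
    by_cases hk : b ≤ k <;> simp [target, hk]
  have h_from : Finset.Icc b D.numClasses = (Finset.Icc 0 D.numClasses).filter (b ≤ ·) := by
    ext k
    simp [and_comm]
  simp only [bufferCost, cost_bufferCells, h_buffer]
  change _ = ∑ k ∈ Finset.Icc 0 D.numClasses, _ + 0 + _
  rw [h_from, Finset.sum_filter, add_zero, ← add_assoc, ← Finset.sum_add_distrib]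
  congr 1
  refine Finset.sum_congr rfl fun k _ => ?_
  split_ifs <;> simp

-- The boundary cannot be increased to `k + 1`, so some buffered cell of class at most `k` lies in
-- a buffer behind region `k`; it was written there because it did not fit into buffer `k`.
lemma WellFormed.exists_skip (h : D.WellFormed ε) {c₀ : Cell α} (h_rejects : D.Rejects c₀.size)
    {k : ℕ} (hk : D.boundary (sizeClass c₀.size) ≤ k) :
    ∃ c ∈ D.bufferCells (D.boundary (sizeClass c₀.size)) ++ [c₀],
      sizeClass c.size ≤ k ∧ ¬ (D.region k).Fits c.size := by
  rcases le_or_gt (sizeClass c₀.size) k with hc₀ | hc₀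
  · exact ⟨c₀, by simp, hc₀, h_rejects k hc₀⟩
  have h_not := Nat.findGreatest_is_greatest (Nat.lt_succ_of_le hk) hc₀
  by_cases h_tail : ∀ c ∈ D.tail, k + 1 ≤ sizeClass c.size
  · obtain ⟨j, hj, c, hc, hck⟩ :
        ∃ j ∈ D.classesFrom (k + 1), ∃ c ∈ (D.region j).buffer, sizeClass c.size < k + 1 := by
      by_contra! h_all
      exact h_not ⟨h_tail, h_all⟩
    obtain ⟨hjn, hkj⟩ := mem_classesFrom.1 hj
    refine ⟨c, ?_, by omega, h.skip_buffer j c hc k (by omega) (by omega)⟩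
    have hj_from := mem_classesFrom.2 ⟨hjn, hk.trans (Nat.le_of_succ_le hkj)⟩
    exact List.mem_append_left _ (List.mem_append_left _ (List.mem_flatMap.2 ⟨j, hj_from, hc⟩))
  · push Not at h_tail
    obtain ⟨c, hc, hck⟩ := h_tail
    exact ⟨c, List.mem_append_left _ (List.mem_append_right _ hc), by omega,
      h.skip_tail c hc k (by omega)⟩

lemma WellFormed.sum_cost_payload_le (h : D.WellFormed ε) (hf : IsCostFunction f) (hε : 0 < ε)
    {m : ℕ} (hm : 1 / ε ≤ 2 ^ m) {c₀ : Cell α} (hc₀ : 0 < c₀.size)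
    (h_rejects : D.Rejects c₀.size) :
    ∑ k ∈ Finset.Icc (D.boundary (sizeClass c₀.size)) D.numClasses, cost f (D.region k).payload
      ≤ 6 / ε * ((m + 3) * (cost f (D.bufferCells (D.boundary (sizeClass c₀.size)))
          + f c₀.size)) := by
  set b := D.boundary (sizeClass c₀.size)
  set s := Finset.Icc b D.numClasses
  set l := D.bufferCells b ++ [c₀]
  have hl : ∀ c ∈ l, 0 < c.size :=
    List.forall_mem_append.2 ⟨(h.sized_bufferCells b).pos, by simpa using hc₀⟩
  have h_payload (k : ℕ) (hk : k ∈ s) : cost f (D.region k).payload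
      ≤ 6 / ε * (cost f (D.region k).buffer + cost f (chargeable (m + 1) k l)) := by
    obtain ⟨c, hc, hck, hskip⟩ := h.exists_skip h_rejects (Finset.mem_Icc.1 hk).1
    exact (h.region k).cost_payload_le hf hε hm hl hc hck hskip
  have h_buffer : ∑ k ∈ s, cost f (D.region k).buffer ≤ cost f l := by
    have h_tail : 0 ≤ cost f D.tail := cost_nonneg hf h.sized_tail.pos
    have := hf.nonneg hc₀
    simp only [l, cost_append, cost_bufferCells, cost_cons, cost_nil]
    linarith
  have h_charge : ∑ k ∈ s, cost f (chargeable (m + 1) k l) ≤ ((m + 1 : ℕ) + 1) * cost f l :=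
    sum_cost_chargeable_le (fun c hc => hf.nonneg (hl c hc)) s (m + 1)
  calc ∑ k ∈ s, cost f (D.region k).payload
      ≤ 6 / ε * (∑ k ∈ s, cost f (D.region k).buffer
          + ∑ k ∈ s, cost f (chargeable (m + 1) k l)) := by
        rw [← Finset.sum_add_distrib, Finset.mul_sum]
        exact Finset.sum_le_sum h_payload
    _ ≤ 6 / ε * ((m + 3) * cost f l) := by
        push_cast at h_charge
        gcongr
        linarith
    _ = 6 / ε * ((m + 3) * (cost f (D.bufferCells b) + f c₀.size)) := by simp [l]

end Layout

/-! ### The cost of a flush -/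

/-- The rate at which buffered cells are charged for the moves of a flush. -/
noncomputable def chargeRate (ε : ℝ) : ℝ := 61 * (1 / ε * Real.logb 2 (1 / ε))

lemma two_le_one_div (hε : 0 < ε) (hε' : ε ≤ 1 / 2) : 2 ≤ 1 / ε := by
  rw [le_div_iff₀ hε]
  linarith

lemma one_le_logb_one_div (hε : 0 < ε) (hε' : ε ≤ 1 / 2) : 1 ≤ Real.logb 2 (1 / ε) := by
  rw [Real.le_logb_iff_rpow_le one_lt_two (by positivity), Real.rpow_one]
  exact two_le_one_div hε hε'

lemma one_le_chargeRate (hε : 0 < ε) (hε' : ε ≤ 1 / 2) : 1 ≤ chargeRate ε := by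
  have h_inv := two_le_one_div hε hε'
  have h_log := one_le_logb_one_div hε hε'
  rw [chargeRate]
  nlinarith

lemma two_mul_chargeRate_add_two_le (hε : 0 < ε) (hε' : ε ≤ 1 / 2) :
    2 * chargeRate ε + 2 ≤ 124 * (1 / ε * Real.logb 2 (1 / ε)) := by
  have h_inv := two_le_one_div hε hε'
  have h_log := one_le_logb_one_div hε hε'
  rw [chargeRate]
  nlinarith

lemma exists_pow_le_chargeRate (hε : 0 < ε) (hε' : ε ≤ 1 / 2) :
    ∃ m : ℕ, 1 / ε ≤ 2 ^ m ∧ 2 + 12 / ε * (m + 3) ≤ chargeRate ε := by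
  have h_inv := two_le_one_div hε hε'
  have h_log := one_le_logb_one_div hε hε'
  refine ⟨⌈Real.logb 2 (1 / ε)⌉₊, ?_, ?_⟩
  · rw [← Real.rpow_natCast, ← Real.logb_le_iff_le_rpow one_lt_two (by positivity)]
    exact Nat.le_ceil _
  · have h_ceil := Nat.ceil_lt_add_one (zero_le_one.trans h_log)
    calc 2 + 12 / ε * (⌈Real.logb 2 (1 / ε)⌉₊ + 3)
        ≤ 1 / ε * Real.logb 2 (1 / ε) + 12 / ε * (5 * Real.logb 2 (1 / ε)) := by
          gcongr
          · nlinarith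
          · linarith
      _ = chargeRate ε := by rw [chargeRate]; ring

namespace Layout

variable {D : Layout α}

lemma WellFormed.sized_startFlush_moves (h : D.WellFormed ε) (s w : ℕ) :
    Sized D.maxLen (startFlush ε D s w).2.moves := by
  have h_buffered := h.sized_buffered (D.boundary s)
  refine (((h_buffered.layOut _).append ?_).append ?_).append ?_
  · exact ((Sized.flatMap fun k => (h.region k).sized_payload).layOut _).subset
      fun _ => List.mem_reverse.1
  · exact .flatMap fun k => (h.region k).sized_payload.layOut _
  · exact .flatMap fun k => (h_buffered.subset (List.filter_subset_self _)).layOut _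

lemma WellFormed.cost_startFlush_moves_le (h : D.WellFormed ε) (hf : IsCostFunction f) (s w : ℕ) :
    cost f (startFlush ε D s w).2.moves
      ≤ 2 * (cost f (D.bufferCells (D.boundary s))
        + ∑ k ∈ Finset.Icc (D.boundary s) D.numClasses, cost f (D.region k).payload) := by
  set b := D.boundary s
  have h_moves : cost f (startFlush ε D s w).2.moves
      = cost f (D.buffered b) + ∑ k ∈ Finset.Icc b D.numClasses, cost f (D.region k).payload
        + ∑ k ∈ Finset.Icc b D.numClasses, cost f (D.region k).payload
        + ∑ k ∈ Finset.Icc b D.numClasses, cost f (ofClass k (D.buffered b)) := by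
    simp only [startFlush, cost_append, cost_layOut, cost_reverse, cost_flatMap,
      sum_map_classesFrom, b]
  have h_buffered : cost f (D.buffered b) ≤ cost f (D.bufferCells b) := by
    rw [buffered_eq_liveCells]
    exact cost_le_of_sublist hf (h.sized_bufferCells b).pos List.filter_sublist
  have h_classes : ∑ k ∈ Finset.Icc b D.numClasses, cost f (ofClass k (D.buffered b))
      ≤ cost f (D.buffered b) :=
    sum_cost_ofClass_le (fun c hc => hf.nonneg ((h.sized_buffered b).pos c hc)) _
  linarith

lemma WellFormed.startFlush_cost_le (h : D.WellFormed ε) (hf : IsCostFunction f) (hε : 0 < ε)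
    (hε' : ε ≤ 1 / 2) {c₀ : Cell α} (hc₀ : 0 < c₀.size) (h_rejects : D.Rejects c₀.size) (w : ℕ) :
    chargeRate ε * (startFlush ε D (sizeClass c₀.size) w).1.bufferCost f
        + cost f (startFlush ε D (sizeClass c₀.size) w).2.moves
      ≤ chargeRate ε * (D.bufferCost f + f c₀.size) := by
  obtain ⟨m, hm, h_rate⟩ := exists_pow_le_chargeRate hε hε'
  set b := D.boundary (sizeClass c₀.size)
  have h_cells : 0 ≤ cost f (D.bufferCells b) := cost_nonneg hf (h.sized_bufferCells b).pos
  have h_trigger : 0 ≤ f c₀.size := hf.nonneg hc₀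
  have h_moves : cost f (startFlush ε D (sizeClass c₀.size) w).2.moves
      ≤ chargeRate ε * (cost f (D.bufferCells b) + f c₀.size) :=
    calc _ ≤ 2 * (cost f (D.bufferCells b)
          + ∑ k ∈ Finset.Icc b D.numClasses, cost f (D.region k).payload) :=
          h.cost_startFlush_moves_le hf _ w
      _ ≤ 2 * (cost f (D.bufferCells b)
          + 6 / ε * ((m + 3) * (cost f (D.bufferCells b) + f c₀.size))) := by
          gcongr
          exact h.sum_cost_payload_le hf hε hm hc₀ h_rejects
      _ ≤ (2 + 12 / ε * (m + 3)) * (cost f (D.bufferCells b) + f c₀.size) := by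
          rw [show 12 / ε = 2 * (6 / ε) by ring]
          linarith
      _ ≤ chargeRate ε * (cost f (D.bufferCells b) + f c₀.size) := by gcongr
  have h_target : (startFlush ε D (sizeClass c₀.size) w).1 = D.target ε b := rfl
  rw [h_target, D.bufferCost_eq_target_add f ε b]
  linarith

end Layout

/-! ### Updates while no flush is in progress -/

namespace Layout

variable {D D₁ : Layout α}

lemma WellFormed.records_newRegion (h : D.WellFormed ε) {c : Cell α} (hc : 0 < c.size)
    (hcΔ : c.size ≤ D.maxLen) (h_tail : D.tail = [])
    (h_empty : ∀ j ∈ D.classesFrom (sizeClass c.size), (D.region j).paySpace = 0) :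
    Records ε D c.size (D.setRegion (sizeClass c.size)
      ⟨[c], c.size, [], ⌊ε * (c.size : ℝ)⌋₊⟩) := by
  have hj : sizeClass c.size ≤ D.numClasses := sizeClass_mono hcΔ
  have h_buffer {l : ℕ} (hl : sizeClass c.size ≤ l) : (D.region l).buffer = [] := by
    refine (h.region l).buffer_eq_nil ?_
    rcases le_or_gt l D.numClasses with hl' | hl'
    · exact h_empty l (mem_classesFrom.2 ⟨hl', hl⟩)
    · exact h.paySpace_eq_zero hl'
  refine ⟨h.setRegion ?_ (by simp) ?_ (by simp [h_tail]), rfl, fun f hf => ?_⟩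
  · exact
      { bufSpace_eq := rfl
        vol_payload_le := by simp
        vol_buffer_le := Nat.zero_le _
        sizeClass_payload := by simp
        sizeClass_buffer := by simp
        sized_payload := .singleton hc hcΔ
        sized_buffer := .nil
        paySpace_eq_zero := fun hlt => absurd hj hlt.not_ge }
  · intro l hl d hd
    simp [h_buffer hl.le] at hd
  · have h_cost := bufferCost_setRegion_add f D hj ⟨[c], c.size, [], ⌊ε * (c.size : ℝ)⌋₊⟩
    rw [h_buffer le_rfl, cost_nil, add_zero, add_zero] at h_cost
    linarith [hf.nonneg hc]

lemma WellFormed.records_of_isThinning (h : D.WellFormed ε) (hD₁ : D₁.IsThinning D) {w : ℕ}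
    (hw : 0 < w) : Records ε D w D₁ :=
  ⟨h.of_isThinning hD₁, hD₁.maxLen_eq, fun f hf => by
    linarith [hD₁.bufferCost_eq f, hf.nonneg hw]⟩

end Layout

open Layout

variable {D D' D₁ : Layout α} {o : Option (Flush α)} {c : Cell α} {Δ : ℕ}

/-- The possible results of an update that writes the cell `c` while no flush is in progress. -/
inductive UpdateStep (ε : ℝ) (D : Layout α) (c : Cell α) : Layout α → Option (Flush α) → Prop
  | stored {D₁ : Layout α} (h : Records ε D c.size D₁) : UpdateStep ε D c D₁ none
  | flushed {D₁ : Layout α} (h : Records ε D c.size D₁) (h_rejects : D₁.Rejects c.size) (w : ℕ) :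
      UpdateStep ε D c (startFlush ε D₁ (sizeClass c.size) w).1
        (some (startFlush ε D₁ (sizeClass c.size) w).2)

lemma size_insertObject (ε : ℝ) (D : Layout α) (x : α) (w : ℕ) :
    (insertObject ε D x w).2.2.size = w := by
  unfold insertObject
  simp only
  split_ifs
  · rfl
  · cases h_store : D.store x w true with
    | none => rfl
    | some r => exact size_eq_of_store_eq_some h_store

lemma updateStep_insertObject (h : D.WellFormed ε) (hc : 0 < c.size) (hcΔ : c.size ≤ D.maxLen) :
    UpdateStep ε D c (insertObject ε D c.name c.size).1
      (insertObject ε D c.name c.size).2.1 := by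
  unfold insertObject
  simp only
  split_ifs with h_new
  · exact .stored (h.records_newRegion (c := ⟨c.name, c.size, _, true⟩) hc hcΔ
      (by simpa using h_new.1) h_new.2)
  · cases h_store : D.store c.name c.size true with
    | some r => exact .stored (h.records_of_store_eq_some hc hcΔ h_store)
    | none =>
      have h_rejects := h.rejects_of_store_eq_none hc h_store
      have h_records : Records ε D c.size
          { D with tail := D.tail ++ [⟨c.name, c.size, D.tailStart + vol D.tail, true⟩] } :=
        h.records_append_tail (c := ⟨c.name, c.size, _, true⟩) hc hcΔ h_rejects
      exact UpdateStep.flushed (c := c) h_records h_rejects c.size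

lemma updateStep_deleteObject [DecidableEq α] (h : D.WellFormed ε) (hc : 0 < c.size)
    (hcΔ : c.size ≤ D.maxLen) :
    UpdateStep ε D c (deleteObject ε D c.name c.size).1 (deleteObject ε D c.name c.size).2 := by
  have h_thin := D.isThinning_remove c.name
  have h_remove := h.of_isThinning h_thin
  unfold deleteObject
  cases h_store : (D.remove c.name).store c.name c.size false with
  | some r =>
    exact .stored ((h_remove.records_of_store_eq_some hc hcΔ h_store).of_isThinning h_thin)
  | none =>
    exact .flushed (h.records_of_isThinning h_thin hc)
      (h_remove.rejects_of_store_eq_none hc h_store) 0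

/-- Perform the update described by the cell `c` while no flush is in progress: insert an object if
`c` is live, delete one otherwise. Returns the layout, the triggered flush if any, and the cells to
which an object is written. -/
noncomputable def performUpdate [DecidableEq α] (ε : ℝ) (D : Layout α) (c : Cell α) :
    Layout α × Option (Flush α) × List (Cell α) :=
  if c.live then
    let q := insertObject ε D c.name c.size
    (q.1, q.2.1, [q.2.2])
  else
    let q := deleteObject ε D c.name c.size
    (q.1, q.2, [])

lemma performUpdate_of_live [DecidableEq α] (hc : c.live = true) :
    performUpdate ε D c = ((insertObject ε D c.name c.size).1,
      (insertObject ε D c.name c.size).2.1, [(insertObject ε D c.name c.size).2.2]) :=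
  if_pos hc

lemma performUpdate_of_not_live [DecidableEq α] (hc : ¬ c.live = true) :
    performUpdate ε D c
      = ((deleteObject ε D c.name c.size).1, (deleteObject ε D c.name c.size).2, []) :=
  if_neg hc

lemma updateStep_performUpdate [DecidableEq α] (h : D.WellFormed ε) (hc : 0 < c.size)
    (hcΔ : c.size ≤ D.maxLen) :
    UpdateStep ε D c (performUpdate ε D c).1 (performUpdate ε D c).2.1 := by
  by_cases h_live : c.live = true
  · rw [performUpdate_of_live h_live]
    exact updateStep_insertObject h hc hcΔ
  · rw [performUpdate_of_not_live h_live]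
    exact updateStep_deleteObject h hc hcΔ

lemma cost_performUpdate_le [DecidableEq α] (hf : IsCostFunction f) (ε : ℝ) (D : Layout α)
    (hc : 0 < c.size) : cost f (performUpdate ε D c).2.2 ≤ f c.size := by
  by_cases h_live : c.live = true
  · simp [performUpdate_of_live h_live, size_insertObject]
  · simpa [performUpdate_of_not_live h_live] using hf.nonneg hc

/-! ### The invariant and the potential -/

/-- The invariant of a layout together with the flush in progress, if any, while the longest object
so far has length `Δ`. -/
structure Consistent (ε : ℝ) (Δ : ℕ) (D : Layout α) (o : Option (Flush α)) : Prop where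
  wellFormed : D.WellFormed ε
  maxLen_eq : D.maxLen = Δ
  sized_moves : ∀ F ∈ o, Sized Δ F.moves
  sized_log : ∀ F ∈ o, Sized Δ F.log

/-- The part of the potential that pays for the rest of the flush in progress: for its moves and,
for each log entry, for writing it and for the increase of the potential when it is performed. -/
noncomputable def flushCost (ε : ℝ) (f : ℕ → ℝ) : Option (Flush α) → ℝ
  | none => 0
  | some F => cost f F.moves + (2 * chargeRate ε + 1) * cost f F.log

lemma flushCost_none (ε : ℝ) (f : ℕ → ℝ) : flushCost ε f (none : Option (Flush α)) = 0 := rfl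

/-- The potential of the amortized analysis. -/
noncomputable def potential (ε : ℝ) (f : ℕ → ℝ) (D : Layout α) (o : Option (Flush α)) : ℝ :=
  chargeRate ε * D.bufferCost f + flushCost ε f o

lemma Consistent.of_none (h : D.WellFormed ε) : Consistent ε D.maxLen D none :=
  ⟨h, rfl, by simp, by simp⟩

lemma Consistent.potential_nonneg (h : Consistent ε Δ D o) (hf : IsCostFunction f) (hε : 0 < ε)
    (hε' : ε ≤ 1 / 2) : 0 ≤ potential ε f D o := by
  have h_rate := one_le_chargeRate hε hε'
  have h_buffer := h.wellFormed.bufferCost_nonneg hf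
  rcases o with _ | F
  · simp only [potential, flushCost]
    positivity
  · have h_moves := cost_nonneg hf (h.sized_moves F rfl).pos
    have h_log := cost_nonneg hf (h.sized_log F rfl).pos
    simp only [potential, flushCost]
    positivity

lemma Consistent.withLog {F : Flush α} (h : Consistent ε Δ D (some F)) {l : List (Cell α)}
    (hl : Sized Δ l) (e : ℕ) : Consistent ε Δ D (some { F with log := l, logEnd := e }) :=
  { h with
    sized_moves := by
      rintro _ ⟨⟩
      exact h.sized_moves F rfl
    sized_log := by
      rintro _ ⟨⟩
      exact hl }

lemma eq_of_mem_bind_settle {F : Flush α} (hF : F ∈ o.bind Flush.settle) : F ∈ o := by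
  obtain ⟨G, hG, hF⟩ := Option.mem_bind_iff.1 hF
  unfold Flush.settle at hF
  split_ifs at hF
  · cases hF
  · exact Option.some.inj hF ▸ hG

lemma Consistent.bind_settle (h : Consistent ε Δ D o) : Consistent ε Δ D (o.bind Flush.settle) :=
  { h with
    sized_moves := fun F hF => h.sized_moves F (eq_of_mem_bind_settle hF)
    sized_log := fun F hF => h.sized_log F (eq_of_mem_bind_settle hF) }

lemma flushCost_bind_settle (ε : ℝ) (f : ℕ → ℝ) (o : Option (Flush α)) :
    flushCost ε f (o.bind Flush.settle) = flushCost ε f o := by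
  rcases o with _ | F
  · rfl
  rw [Option.bind_some, Flush.settle]
  split_ifs with h_done
  · simp [flushCost, List.isEmpty_iff.1 h_done.1, List.isEmpty_iff.1 h_done.2]
  · rfl

namespace UpdateStep

lemma consistent (h : UpdateStep ε D c D' o) : Consistent ε D.maxLen D' o := by
  cases h with
  | stored h => exact h.maxLen_eq ▸ .of_none h.wellFormed
  | flushed h h_rejects w =>
    refine ⟨h.wellFormed.target _, h.maxLen_eq, ?_, ?_⟩
    · rintro F ⟨⟩
      exact h.maxLen_eq ▸ h.wellFormed.sized_startFlush_moves _ w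
    · rintro F ⟨⟩
      exact .nil

lemma log_eq_nil (h : UpdateStep ε D c D' o) : ∀ F ∈ o, F.log = [] := by
  cases h with
  | stored h => simp
  | flushed h h_rejects w => rintro F ⟨⟩; rfl

lemma potential_le (h : UpdateStep ε D c D' o) (hf : IsCostFunction f) (hε : 0 < ε)
    (hε' : ε ≤ 1 / 2) (hc : 0 < c.size) :
    potential ε f D' o ≤ chargeRate ε * D.bufferCost f + 2 * chargeRate ε * f c.size := by
  have h_rate : 0 ≤ chargeRate ε := zero_le_one.trans (one_le_chargeRate hε hε')
  have h_update : 0 ≤ f c.size := hf.nonneg hc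
  cases h with
  | stored h =>
    calc chargeRate ε * D'.bufferCost f + 0
        ≤ chargeRate ε * (D.bufferCost f + 2 * f c.size) := by
          rw [add_zero]
          exact mul_le_mul_of_nonneg_left (by linarith [h.bufferCost_le f hf]) h_rate
      _ = _ := by ring
  | @flushed D₁ h h_rejects w =>
    calc potential ε f _ (some (startFlush ε D₁ (sizeClass c.size) w).2)
        ≤ chargeRate ε * (D₁.bufferCost f + f c.size) := by
          simpa [potential, flushCost, startFlush] using
            h.wellFormed.startFlush_cost_le hf hε hε' hc h_rejects w
      _ ≤ chargeRate ε * (D.bufferCost f + 2 * f c.size) :=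
          mul_le_mul_of_nonneg_left (by linarith [h.bufferCost_le f hf]) h_rate
      _ = _ := by ring

end UpdateStep

/-! ### Work on a flush in progress -/

/-- Bounds the cost of processing cells of size at most `Δ` one after the other, as long as the
volume processed does not exceed a budget of which `r` is left. -/
noncomputable def allowance (f : ℕ → ℝ) (Δ : ℕ) (r : ℝ) : ℝ :=
  if 0 ≤ r then r * f 1 + f Δ else 0

lemma allowance_nonneg (hf : IsCostFunction f) (hΔ : 0 < Δ) (r : ℝ) : 0 ≤ allowance f Δ r := by
  have h_one := hf.nonneg one_pos
  have h_max := hf.nonneg hΔ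
  unfold allowance
  split_ifs <;> positivity

lemma add_allowance_le (hf : IsCostFunction f) {w : ℕ} (hw : 0 < w) (hwΔ : w ≤ Δ) {r : ℝ}
    (hr : 0 ≤ r) : f w + allowance f Δ (r - w) ≤ allowance f Δ r := by
  rw [allowance, allowance, if_pos hr]
  split_ifs
  · have h_unit := hf.map_mul_le hw one_pos
    rw [mul_one] at h_unit
    linarith
  · linarith [mul_nonneg hr (hf.nonneg one_pos), hf.mono w Δ hw hwΔ]

section

variable [DecidableEq α] {budget : ℝ} {done logEnd : ℕ} {F : Flush α} {cs : List (Cell α)}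

lemma runMoves_cons_of_le (h_done : done ≤ budget) (D : Layout α) (m : Cell α)
    (ms : List (Cell α)) :
    runMoves budget done D (m :: ms) =
      let r := runMoves budget (done + m.size) (D.relocate m) ms
      (r.1, r.2.1, r.2.2.1, m :: r.2.2.2) :=
  if_pos h_done

lemma runMoves_of_lt (h_done : budget < done) (D : Layout α) (ms : List (Cell α)) :
    runMoves budget done D ms = (done, D, ms, []) := by
  cases ms with
  | nil => rfl
  | cons m ms => exact if_neg h_done.not_ge

lemma isThinning_runMoves (budget : ℝ) (done : ℕ) (D : Layout α) (ms : List (Cell α)) :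
    (runMoves budget done D ms).2.1.IsThinning D := by
  induction ms generalizing done D with
  | nil => exact .refl D
  | cons m ms ih =>
    rcases le_or_gt (done : ℝ) budget with h_done | h_done
    · rw [runMoves_cons_of_le h_done]
      exact (ih _ _).trans (isThinning_relocate D m)
    · rw [runMoves_of_lt h_done]
      exact .refl D

lemma runMoves_append (budget : ℝ) (done : ℕ) (D : Layout α) (ms : List (Cell α)) :
    (runMoves budget done D ms).2.2.2 ++ (runMoves budget done D ms).2.2.1 = ms := by
  induction ms generalizing done D with
  | nil => rfl
  | cons m ms ih =>
    rcases le_or_gt (done : ℝ) budget with h_done | h_done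
    · rw [runMoves_cons_of_le h_done]
      exact congrArg (m :: ·) (ih _ _)
    · rw [runMoves_of_lt h_done, List.nil_append]

lemma runMoves_cost_le (hf : IsCostFunction f) (budget : ℝ) (done : ℕ) (D : Layout α)
    {ms : List (Cell α)} (h_ms : Sized Δ ms) :
    cost f (runMoves budget done D ms).2.2.2
        + allowance f Δ (budget - (runMoves budget done D ms).1)
      ≤ allowance f Δ (budget - done) := by
  induction ms generalizing done D with
  | nil => simp [runMoves]
  | cons m ms ih =>
    rcases le_or_gt (done : ℝ) budget with h_done | h_done
    · obtain ⟨hm, hmΔ⟩ := h_ms m (by simp)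
      have h_rest := ih (done + m.size) (D.relocate m) (h_ms.subset (List.subset_cons_self m ms))
      have h_move := add_allowance_le hf hm hmΔ (sub_nonneg.2 h_done)
      rw [runMoves_cons_of_le h_done]
      rw [Nat.cast_add, ← sub_sub] at h_rest
      simp only [cost_cons]
      linarith
    · simp [runMoves_of_lt h_done]

lemma runLog_cons_of_eq_none (h_done : done ≤ budget) (h : (performUpdate ε D c).2.1 = none)
    (logEnd : ℕ) (cs : List (Cell α)) :
    runLog ε budget logEnd done D (c :: cs) =
      let q := runLog ε budget logEnd (done + c.size) (performUpdate ε D c).1 cs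
      (q.1, q.2.1, (performUpdate ε D c).2.2 ++ q.2.2) := by
  rw [runLog, if_pos h_done]
  change (match (performUpdate ε D c).2.1 with | none => _ | some _ => _) = _
  rw [h]
  rfl

lemma runLog_cons_of_eq_some (h_done : done ≤ budget) (h : (performUpdate ε D c).2.1 = some F)
    (logEnd : ℕ) (cs : List (Cell α)) :
    runLog ε budget logEnd done D (c :: cs) =
      ((performUpdate ε D c).1,
        (some { F with
          log := cs
          logEnd := if cs.isEmpty then F.logEnd else max F.logEnd logEnd }).bind Flush.settle,
        (performUpdate ε D c).2.2) := by
  rw [runLog, if_pos h_done]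
  change (match (performUpdate ε D c).2.1 with | none => _ | some _ => _) = _
  rw [h]
  rfl

lemma runLog_cons_of_lt (h_done : budget < done) (ε : ℝ) (D : Layout α) (c : Cell α) (logEnd : ℕ)
    (cs : List (Cell α)) :
    runLog ε budget logEnd done D (c :: cs) = (D, some ⟨[], c :: cs, logEnd⟩, []) :=
  if_neg h_done.not_ge

lemma runLog_consistent (budget : ℝ) (logEnd done : ℕ) (h : D.WellFormed ε)
    (h_log : Sized D.maxLen cs) :
    Consistent ε D.maxLen (runLog ε budget logEnd done D cs).1
      (runLog ε budget logEnd done D cs).2.1 := by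
  induction cs generalizing done D with
  | nil => exact .of_none h
  | cons c cs ih =>
    have h_rest : Sized D.maxLen cs := h_log.subset (List.subset_cons_self c cs)
    rcases le_or_gt (done : ℝ) budget with h_done | h_done
    · obtain ⟨hc, hcΔ⟩ := h_log c (by simp)
      have h_step := (updateStep_performUpdate h hc hcΔ).consistent
      rcases h_flush : (performUpdate ε D c).2.1 with _ | F
      · rw [runLog_cons_of_eq_none h_done h_flush]
        have h_maxLen := h_step.maxLen_eq
        exact h_maxLen ▸ ih (done + c.size) h_step.wellFormed (h_maxLen ▸ h_rest)
      · rw [runLog_cons_of_eq_some h_done h_flush]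
        rw [h_flush] at h_step
        exact (h_step.withLog h_rest _).bind_settle
    · rw [runLog_cons_of_lt h_done]
      refine ⟨h, rfl, ?_, ?_⟩
      · rintro _ ⟨⟩
        exact .nil
      · rintro _ ⟨⟩
        exact h_log

lemma runLog_potential_le (hf : IsCostFunction f) (hε : 0 < ε) (hε' : ε ≤ 1 / 2) (budget : ℝ)
    (logEnd done : ℕ) (h : D.WellFormed ε) (h_log : Sized D.maxLen cs) :
    cost f (runLog ε budget logEnd done D cs).2.2
        + potential ε f (runLog ε budget logEnd done D cs).1
            (runLog ε budget logEnd done D cs).2.1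
      ≤ chargeRate ε * D.bufferCost f + (2 * chargeRate ε + 1) * cost f cs := by
  induction cs generalizing done D with
  | nil => simp [runLog, potential, flushCost]
  | cons c cs ih =>
    rcases le_or_gt (done : ℝ) budget with h_done | h_done
    · obtain ⟨hc, hcΔ⟩ := h_log c (by simp)
      have h_rest : Sized D.maxLen cs := h_log.subset (List.subset_cons_self c cs)
      have h_step := updateStep_performUpdate h hc hcΔ
      have h_write := cost_performUpdate_le hf ε D hc
      have h_potential := h_step.potential_le hf hε hε' hc
      rcases h_flush : (performUpdate ε D c).2.1 with _ | F
      · have h_ih := ih (done + c.size) h_step.consistent.wellFormed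
          (h_step.consistent.maxLen_eq ▸ h_rest)
        rw [runLog_cons_of_eq_none h_done h_flush]
        simp only [h_flush, potential, flushCost, cost_append, cost_cons] at h_potential h_ih ⊢
        linarith
      · have h_fresh := h_step.log_eq_nil F h_flush
        rw [runLog_cons_of_eq_some h_done h_flush]
        simp only [potential, flushCost_bind_settle]
        simp only [h_flush, h_fresh, potential, flushCost, cost_nil, cost_cons] at h_potential ⊢
        linarith
    · simp [runLog_cons_of_lt h_done, potential, flushCost]

lemma runLog_cost_le (hf : IsCostFunction f) (budget : ℝ) (logEnd done : ℕ)
    (h : D.WellFormed ε) (h_maxLen : 0 < D.maxLen) (h_log : Sized D.maxLen cs) :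
    cost f (runLog ε budget logEnd done D cs).2.2 ≤ allowance f D.maxLen (budget - done) := by
  induction cs generalizing done D with
  | nil => exact allowance_nonneg hf h_maxLen _
  | cons c cs ih =>
    rcases le_or_gt (done : ℝ) budget with h_done | h_done
    · obtain ⟨hc, hcΔ⟩ := h_log c (by simp)
      have h_rest : Sized D.maxLen cs := h_log.subset (List.subset_cons_self c cs)
      have h_step := (updateStep_performUpdate h hc hcΔ).consistent
      have h_write := cost_performUpdate_le hf ε D hc
      have h_allowance := add_allowance_le hf hc hcΔ (sub_nonneg.2 h_done)
      rcases h_flush : (performUpdate ε D c).2.1 with _ | F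
      · have h_ih := ih (done + c.size) h_step.wellFormed (h_step.maxLen_eq ▸ h_maxLen)
          (h_step.maxLen_eq ▸ h_rest)
        rw [h_step.maxLen_eq, Nat.cast_add, ← sub_sub] at h_ih
        rw [runLog_cons_of_eq_none h_done h_flush]
        simp only [cost_append]
        linarith
      · rw [runLog_cons_of_eq_some h_done h_flush]
        linarith [allowance_nonneg hf h_maxLen (budget - done - c.size)]
    · rw [runLog_cons_of_lt h_done]
      exact allowance_nonneg hf h_maxLen _

lemma work_eq_of_pending_eq_nil (h : (runMoves budget 0 D F.moves).2.2.1 = []) (ε : ℝ) :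
    work ε budget D F =
      let r := runMoves budget 0 D F.moves
      let q := runLog ε budget F.logEnd r.1 r.2.1 F.log
      (q.1, q.2.1, r.2.2.2 ++ q.2.2) :=
  if_pos (List.isEmpty_iff.2 h)

lemma work_eq_of_pending_ne_nil (h : (runMoves budget 0 D F.moves).2.2.1 ≠ []) (ε : ℝ) :
    work ε budget D F =
      let r := runMoves budget 0 D F.moves
      (r.2.1, some { F with moves := r.2.2.1 }, r.2.2.2) :=
  if_neg fun h_empty => h (List.isEmpty_iff.1 h_empty)

lemma Consistent.wellFormed_runMoves (h : Consistent ε Δ D (some F)) (budget : ℝ) :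
    (runMoves budget 0 D F.moves).2.1.WellFormed ε
      ∧ (runMoves budget 0 D F.moves).2.1.maxLen = Δ := by
  have h_thin := isThinning_runMoves budget 0 D F.moves
  exact ⟨h.wellFormed.of_isThinning h_thin, h_thin.maxLen_eq.trans h.maxLen_eq⟩

lemma work_consistent (h : Consistent ε Δ D (some F)) (budget : ℝ) :
    Consistent ε Δ (work ε budget D F).1 (work ε budget D F).2.1 := by
  obtain ⟨h_moved, h_maxLen⟩ := h.wellFormed_runMoves budget
  by_cases h_pending : (runMoves budget 0 D F.moves).2.2.1 = []
  · rw [work_eq_of_pending_eq_nil h_pending]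
    exact h_maxLen ▸ runLog_consistent budget F.logEnd _ h_moved (h_maxLen ▸ h.sized_log F rfl)
  · rw [work_eq_of_pending_ne_nil h_pending]
    refine ⟨h_moved, h_maxLen, ?_, ?_⟩
    · rintro _ ⟨⟩
      refine (h.sized_moves F rfl).subset ?_
      conv_rhs => rw [← runMoves_append budget 0 D F.moves]
      exact List.subset_append_right _ _
    · rintro _ ⟨⟩
      exact h.sized_log F rfl

lemma work_potential_le (h : Consistent ε Δ D (some F)) (hf : IsCostFunction f) (hε : 0 < ε)
    (hε' : ε ≤ 1 / 2) (budget : ℝ) :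
    cost f (work ε budget D F).2.2 + potential ε f (work ε budget D F).1 (work ε budget D F).2.1
      ≤ potential ε f D (some F) := by
  obtain ⟨h_moved, h_maxLen⟩ := h.wellFormed_runMoves budget
  have h_buffer := (isThinning_runMoves budget 0 D F.moves).bufferCost_eq f
  have h_moves := congrArg (cost f) (runMoves_append budget 0 D F.moves)
  by_cases h_pending : (runMoves budget 0 D F.moves).2.2.1 = []
  · have h_log := runLog_potential_le hf hε hε' budget F.logEnd
      (runMoves budget 0 D F.moves).1 h_moved (h_maxLen ▸ h.sized_log F rfl)
    rw [work_eq_of_pending_eq_nil h_pending]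
    rw [h_pending, List.append_nil] at h_moves
    rw [h_buffer] at h_log
    simp only [potential, flushCost, cost_append] at h_log ⊢
    linarith
  · rw [work_eq_of_pending_ne_nil h_pending]
    simp only [potential, flushCost, h_buffer, cost_append] at h_moves ⊢
    linarith

lemma work_cost_le (h : Consistent ε Δ D (some F)) (hf : IsCostFunction f) (hΔ : 0 < Δ)
    (budget : ℝ) : cost f (work ε budget D F).2.2 ≤ allowance f Δ budget := by
  obtain ⟨h_moved, h_maxLen⟩ := h.wellFormed_runMoves budget
  have h_moves := runMoves_cost_le hf budget 0 D (h.sized_moves F rfl)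
  rw [Nat.cast_zero, sub_zero] at h_moves
  by_cases h_pending : (runMoves budget 0 D F.moves).2.2.1 = []
  · have h_log := runLog_cost_le hf budget F.logEnd (runMoves budget 0 D F.moves).1 h_moved
      (h_maxLen ▸ hΔ) (h_maxLen ▸ h.sized_log F rfl)
    rw [h_maxLen] at h_log
    rw [work_eq_of_pending_eq_nil h_pending]
    simp only [cost_append]
    linarith
  · rw [work_eq_of_pending_ne_nil h_pending]
    linarith [allowance_nonneg hf hΔ (budget - (runMoves budget 0 D F.moves).1)]

end

/-! ### Serving requests -/

/-- The log entry for the request `r`: the inserted object, or a delete record. -/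
def Request.cell (act : α → Option ℕ) (addr : ℕ) : Request α → Cell α
  | .insert x w => ⟨x, w, addr, true⟩
  | .delete x => ⟨x, (act x).getD 0, addr, false⟩

lemma size_cell (act : α → Option ℕ) (addr : ℕ) (r : Request α) :
    (r.cell act addr).size = r.len act := by
  cases r <;> rfl

/-- The layout with `Δ` updated to the arrival of the request `r`. -/
def State.layoutFor (S : State α) (r : Request α) : Layout α :=
  S.layout.withMaxLen (max S.layout.maxLen (longest [r]))

lemma longest_concat (σ : List (Request α)) (r : Request α) :
    longest (σ ++ [r]) = max (longest σ) (longest [r]) := by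
  induction σ with
  | nil => simp [longest]
  | cons q σ ih => cases q <;> simp [longest, ih, max_assoc]

section

variable {S : State α} {r : Request α}

/-- The invariant of the reallocator while the longest object so far has length `Δ`. -/
structure State.Valid (ε : ℝ) (Δ : ℕ) (S : State α) : Prop where
  consistent : Consistent ε Δ S.layout S.flush
  table_sized : ∀ x w, S.table x = some w → 0 < w ∧ w ≤ Δ

lemma cost_liveCells_singleton_le (hf : IsCostFunction f) (hc : 0 < c.size) :
    cost f (liveCells [c]) ≤ f c.size := by
  by_cases h_live : c.live = true
  · simp [liveCells, h_live]
  · simpa [liveCells, h_live] using hf.nonneg hc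

lemma wellFormed_init (ε : ℝ) : (State.init : State α).layout.WellFormed ε where
  region k := by constructor <;> simp [State.init, Sized]
  sized_tail := .nil
  skip_buffer := by simp [State.init]
  skip_tail := by simp [State.init]

lemma valid_init (ε : ℝ) : (State.init : State α).Valid ε 0 where
  consistent := .of_none (wellFormed_init ε)
  table_sized := by simp [State.init]

lemma potential_init (ε : ℝ) (f : ℕ → ℝ) :
    potential ε f (State.init : State α).layout State.init.flush = 0 := by
  simp [State.init, potential, flushCost_none, bufferCost, cost_bufferCells]

namespace State.Valid

lemma len_pos (h : S.Valid ε Δ) (hr : r.Legal S.table) : 0 < r.len S.table := by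
  cases r with
  | insert x w => exact hr.1
  | delete x =>
    obtain ⟨w, hw⟩ := Option.ne_none_iff_exists'.1 hr
    simpa [Request.len, hw] using (h.table_sized x w hw).1

lemma len_le (h : S.Valid ε Δ) (hr : r.Legal S.table) :
    r.len S.table ≤ max Δ (longest [r]) := by
  cases r with
  | insert x w => simp [Request.len, longest]
  | delete x =>
    obtain ⟨w, hw⟩ := Option.ne_none_iff_exists'.1 hr
    simpa [Request.len, longest, hw] using (h.table_sized x w hw).2

lemma consistent_layoutFor (h : S.Valid ε Δ) (r : Request α) :
    Consistent ε (max Δ (longest [r])) (S.layoutFor r) S.flush where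
  wellFormed := h.consistent.wellFormed.withMaxLen (le_max_left _ _)
  maxLen_eq := congrArg (max · _) h.consistent.maxLen_eq
  sized_moves F hF := (h.consistent.sized_moves F hF).mono (le_max_left _ _)
  sized_log F hF := (h.consistent.sized_log F hF).mono (le_max_left _ _)

lemma bufferCost_layoutFor (h : S.Valid ε Δ) (f : ℕ → ℝ) (r : Request α) :
    (S.layoutFor r).bufferCost f = S.layout.bufferCost f :=
  h.consistent.wellFormed.bufferCost_withMaxLen (le_max_left _ _) f

lemma consistent_append_log (h : S.Valid ε Δ) (hr : r.Legal S.table) {F : Flush α}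
    (hS : S.flush = some F) (addr e : ℕ) :
    Consistent ε (max Δ (longest [r])) (S.layoutFor r)
      (some { F with log := F.log ++ [r.cell S.table addr], logEnd := e }) := by
  have h_layout := h.consistent_layoutFor r
  have h_size := size_cell S.table addr r
  rw [hS] at h_layout
  exact h_layout.withLog ((h_layout.sized_log F rfl).append
    (.singleton (h_size ▸ h.len_pos hr) (h_size ▸ h.len_le hr))) e

end State.Valid

variable [DecidableEq α]

lemma serve_of_flush_eq_none (ε : ℝ) (hS : S.flush = none) (r : Request α) :
    serve ε S r =
      let q := performUpdate ε (S.layoutFor r) (r.cell S.table 0)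
      (⟨r.apply S.table, q.1, q.2.1.bind Flush.settle⟩, q.2.2) := by
  cases r <;> simp [serve, hS, performUpdate, State.layoutFor, withMaxLen, Request.cell, longest]

lemma serve_of_flush_eq_some (ε : ℝ) {F : Flush α} (hS : S.flush = some F) (r : Request α) :
    serve ε S r =
      let c := r.cell S.table F.logEnd
      let q := work ε (4 / ε * c.size) (S.layoutFor r)
        { F with log := F.log ++ [c], logEnd := F.logEnd + c.size }
      (⟨r.apply S.table, q.1, q.2.1⟩, liveCells [c] ++ q.2.2) := by
  cases r <;> simp [serve, hS, State.layoutFor, withMaxLen, Request.cell, longest, liveCells]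

lemma table_serve (ε : ℝ) (S : State α) (r : Request α) :
    (serve ε S r).1.table = r.apply S.table := by
  rcases hS : S.flush with _ | F
  · rw [serve_of_flush_eq_none ε hS]
  · rw [serve_of_flush_eq_some ε hS]

namespace State.Valid

lemma updateStep_performUpdate (h : S.Valid ε Δ) (hr : r.Legal S.table) (addr : ℕ) :
    UpdateStep ε (S.layoutFor r) (r.cell S.table addr)
      (performUpdate ε (S.layoutFor r) (r.cell S.table addr)).1
      (performUpdate ε (S.layoutFor r) (r.cell S.table addr)).2.1 := by
  have h_layout := h.consistent_layoutFor r
  have h_size := size_cell S.table addr r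
  exact StorageReallocation.updateStep_performUpdate h_layout.wellFormed
    (h_size ▸ h.len_pos hr) (h_layout.maxLen_eq ▸ h_size ▸ h.len_le hr)

lemma apply_table_sized (h : S.Valid ε Δ) (hr : r.Legal S.table) {x : α} {w : ℕ}
    (hw : r.apply S.table x = some w) : 0 < w ∧ w ≤ max Δ (longest [r]) := by
  have h_old (hw : S.table x = some w) : 0 < w ∧ w ≤ max Δ (longest [r]) :=
    ⟨(h.table_sized x w hw).1, (h.table_sized x w hw).2.trans (le_max_left _ _)⟩
  cases r with
  | insert y v =>
    rcases eq_or_ne x y with rfl | hxy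
    · obtain rfl : v = w := by simpa [Request.apply] using hw
      exact ⟨h.len_pos hr, h.len_le hr⟩
    · exact h_old (by simpa [Request.apply, hxy] using hw)
  | delete y =>
    rcases eq_or_ne x y with rfl | hxy
    · simp [Request.apply] at hw
    · exact h_old (by simpa [Request.apply, hxy] using hw)

lemma serve (h : S.Valid ε Δ) (hr : r.Legal S.table) :
    (serve ε S r).1.Valid ε (max Δ (longest [r])) where
  consistent := by
    rcases hS : S.flush with _ | F
    · have h_step := (h.updateStep_performUpdate hr 0).consistent
      rw [serve_of_flush_eq_none ε hS]
      exact (h.consistent_layoutFor r).maxLen_eq ▸ h_step.bind_settle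
    · rw [serve_of_flush_eq_some ε hS]
      exact work_consistent (h.consistent_append_log hr hS _ _) _
  table_sized x w hw := h.apply_table_sized hr (table_serve ε S r ▸ hw)

lemma serve_potential_le (h : S.Valid ε Δ) (hr : r.Legal S.table) (hf : IsCostFunction f)
    (hε : 0 < ε) (hε' : ε ≤ 1 / 2) :
    cost f (StorageReallocation.serve ε S r).2
        + potential ε f (StorageReallocation.serve ε S r).1.layout
            (StorageReallocation.serve ε S r).1.flush
      ≤ potential ε f S.layout S.flush + (2 * chargeRate ε + 2) * f (r.len S.table) := by
  have h_size (addr : ℕ) := size_cell S.table addr r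
  have h_pos (addr : ℕ) : 0 < (r.cell S.table addr).size := h_size addr ▸ h.len_pos hr
  have h_update := hf.nonneg (h.len_pos hr)
  have h_buffer := h.bufferCost_layoutFor f r
  rcases hS : S.flush with _ | F
  · have h_write := cost_performUpdate_le hf ε (S.layoutFor r) (h_pos 0)
    have h_step := (h.updateStep_performUpdate hr 0).potential_le hf hε hε' (h_pos 0)
    rw [serve_of_flush_eq_none ε hS]
    simp only [potential, flushCost_bind_settle, h_buffer, h_size] at h_write h_step ⊢
    rw [flushCost_none, add_zero]
    linarith
  · have h_write := cost_liveCells_singleton_le hf (h_pos F.logEnd)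
    have h_work := work_potential_le (h.consistent_append_log hr hS F.logEnd
      (F.logEnd + (r.cell S.table F.logEnd).size)) hf hε hε'
      (4 / ε * (r.cell S.table F.logEnd).size)
    rw [serve_of_flush_eq_some ε hS]
    simp only [potential, flushCost, h_buffer, h_size, cost_append, cost_cons, cost_nil]
      at h_write h_work ⊢
    linarith

lemma serve_cost_le (h : S.Valid ε Δ) (hr : r.Legal S.table) (hf : IsCostFunction f) :
    cost f (StorageReallocation.serve ε S r).2
      ≤ f (r.len S.table) + allowance f (max Δ (longest [r])) (4 / ε * r.len S.table) := by
  have h_size (addr : ℕ) := size_cell S.table addr r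
  have h_pos (addr : ℕ) : 0 < (r.cell S.table addr).size := h_size addr ▸ h.len_pos hr
  have h_max : 0 < max Δ (longest [r]) := (h.len_pos hr).trans_le (h.len_le hr)
  rcases hS : S.flush with _ | F
  · have h_write := cost_performUpdate_le hf ε (S.layoutFor r) (h_pos 0)
    rw [serve_of_flush_eq_none ε hS]
    rw [h_size] at h_write
    linarith [allowance_nonneg hf h_max (4 / ε * r.len S.table)]
  · have h_write := cost_liveCells_singleton_le hf (h_pos F.logEnd)
    have h_work := work_cost_le (h.consistent_append_log hr hS F.logEnd
      (F.logEnd + (r.cell S.table F.logEnd).size)) hf h_max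
      (4 / ε * (r.cell S.table F.logEnd).size)
    rw [serve_of_flush_eq_some ε hS]
    simp only [h_size, cost_append] at h_write h_work ⊢
    linarith

end State.Valid

/-! ### Executions -/

lemma stateAfter_concat (ε : ℝ) (σ : List (Request α)) (r : Request α) :
    stateAfter ε (σ ++ [r]) = (serve ε (stateAfter ε σ) r).1 :=
  List.foldl_concat ..

lemma active_concat (σ : List (Request α)) (r : Request α) :
    active (σ ++ [r]) = r.apply (active σ) :=
  List.foldl_concat ..

lemma table_stateAfter (ε : ℝ) (σ : List (Request α)) : (stateAfter ε σ).table = active σ := by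
  induction σ using List.reverseRecOn with
  | nil => rfl
  | append_singleton σ r ih => rw [stateAfter_concat, table_serve, active_concat, ih]

lemma sum_le_sum_of_potential {n : ℕ} {a b : Fin n → ℝ} (Φ : ℕ → ℝ) (h_init : Φ 0 = 0)
    (h_final : 0 ≤ Φ n) (h_step : ∀ t : Fin n, a t + Φ (t + 1) ≤ Φ t + b t) :
    ∑ t, a t ≤ ∑ t, b t :=
  calc ∑ t, a t ≤ ∑ t, (b t + (Φ t - Φ (t + 1))) :=
        Finset.sum_le_sum fun t _ => by linarith [h_step t]
    _ = ∑ t, b t + (Φ 0 - Φ n) := by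
        rw [Finset.sum_add_distrib, Fin.sum_univ_eq_sum_range (fun t => Φ t - Φ (t + 1)),
          Finset.sum_range_sub']
    _ ≤ ∑ t, b t := by linarith

namespace IsExecution

variable {σ : List (Request α)} {t : ℕ}

lemma legal (hσ : IsExecution σ) (ε : ℝ) (ht : t < σ.length) :
    σ[t].Legal (stateAfter ε (σ.take t)).table := by
  rw [table_stateAfter]
  exact hσ t ht

lemma valid_stateAfter (hσ : IsExecution σ) (ε : ℝ) (ht : t ≤ σ.length) :
    (stateAfter ε (σ.take t)).Valid ε (longest (σ.take t)) := by
  induction t with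
  | zero => exact valid_init ε
  | succ t ih =>
    rw [List.take_succ_eq_append_getElem ht, stateAfter_concat, longest_concat]
    exact (ih (Nat.le_of_succ_le ht)).serve (hσ.legal ε ht)

lemma len_pos (hσ : IsExecution σ) (ht : t < σ.length) :
    0 < σ[t].len (active (σ.take t)) := by
  have h := (hσ.valid_stateAfter 0 ht.le).len_pos (hσ.legal 0 ht)
  rwa [table_stateAfter] at h

lemma len_le_longest (hσ : IsExecution σ) (ht : t < σ.length) :
    σ[t].len (active (σ.take t)) ≤ longest (σ.take (t + 1)) := by
  have h := (hσ.valid_stateAfter 0 ht.le).len_le (hσ.legal 0 ht)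
  rwa [table_stateAfter, ← longest_concat, ← List.take_succ_eq_append_getElem ht] at h

lemma sum_requestCost_le (hσ : IsExecution σ) (hf : IsCostFunction f) (hε : 0 < ε)
    (hε' : ε ≤ 1 / 2) :
    ∑ t : Fin σ.length, requestCost ε f (σ.take t) (σ.get t)
      ≤ ∑ t : Fin σ.length, (2 * chargeRate ε + 2) * f ((σ.get t).len (active (σ.take t))) := by
  refine sum_le_sum_of_potential
    (fun t => potential ε f (stateAfter ε (σ.take t)).layout (stateAfter ε (σ.take t)).flush)
    (potential_init ε f)
    ((hσ.valid_stateAfter ε le_rfl).consistent.potential_nonneg hf hε hε') fun t => ?_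
  have h_serve :=
    (hσ.valid_stateAfter ε t.2.le).serve_potential_le (hσ.legal ε t.2) hf hε hε'
  rwa [← stateAfter_concat, ← List.take_succ_eq_append_getElem t.2, table_stateAfter] at h_serve

lemma requestCost_le (hσ : IsExecution σ) (hf : IsCostFunction f) (hε : 0 < ε)
    (ht : t < σ.length) :
    requestCost ε f (σ.take t) σ[t]
      ≤ 4 * (1 / ε * σ[t].len (active (σ.take t)) * f 1) + 2 * f (longest (σ.take (t + 1))) := by
  have h_serve : requestCost ε f (σ.take t) σ[t] ≤ _ :=
    (hσ.valid_stateAfter ε ht.le).serve_cost_le (hσ.legal ε ht) hf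
  have h_len := hf.mono _ _ (hσ.len_pos ht) (hσ.len_le_longest ht)
  rw [← longest_concat, ← List.take_succ_eq_append_getElem ht, table_stateAfter, allowance,
    if_pos (by positivity)] at h_serve
  have h_budget : 4 / ε * σ[t].len (active (σ.take t)) * f 1
      = 4 * (1 / ε * σ[t].len (active (σ.take t)) * f 1) := by ring
  linarith

end IsExecution

end

end StorageReallocation

theorem mainTheorem6 :
    ∃ C : ℝ, 0 < C ∧
      ∀ (α : Type*) [DecidableEq α] (ε : ℝ), 0 < ε → ε ≤ 1 / 2 →
      ∀ f : ℕ → ℝ, StorageReallocation.IsCostFunction f →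
      ∀ σ : List (StorageReallocation.Request α), StorageReallocation.IsExecution σ →
        -- amortized cost
        (∑ t : Fin σ.length, StorageReallocation.requestCost ε f (σ.take t) σ[t]
          ≤ ∑ t : Fin σ.length,
              C * (f (σ[t].len (StorageReallocation.active (σ.take t)))
                * ((1 / ε) * Real.logb 2 (1 / ε)))) ∧
        -- worst-case cost of each request
        (∀ t : Fin σ.length,
          StorageReallocation.requestCost ε f (σ.take t) σ[t]
            ≤ C * ((1 / ε) * (σ[t].len (StorageReallocation.active (σ.take t)) : ℝ) * f 1
                + f (StorageReallocation.longest (σ.take (t + 1))))) := by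
  open StorageReallocation in
  refine ⟨124, by norm_num, fun α _ ε hε hε' f hf σ hσ => ⟨?_, fun t => ?_⟩⟩
  · refine (hσ.sum_requestCost_le hf hε hε').trans (Finset.sum_le_sum fun t _ => ?_)
    have h_len : 0 ≤ f (σ[t].len (active (σ.take t))) := hf.nonneg (hσ.len_pos t.2)
    have h_rate := two_mul_chargeRate_add_two_le hε hε'
    calc (2 * chargeRate ε + 2) * f (σ[t].len (active (σ.take t)))
        ≤ 124 * (1 / ε * Real.logb 2 (1 / ε)) * f (σ[t].len (active (σ.take t))) := by gcongr
      _ = _ := by ring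
  · have h_longest : 0 ≤ f (longest (σ.take (t + 1))) :=
      hf.nonneg ((hσ.len_pos t.2).trans_le (hσ.len_le_longest t.2))
    have h_unit : 0 ≤ 1 / ε * σ[t].len (active (σ.take t)) * f 1 := by
      have := hf.nonneg one_pos
      positivity
    refine (hσ.requestCost_le hf hε t.2).trans ?_
    simp only [Fin.getElem_fin] at h_unit ⊢
    linarith
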